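/- Let $a$ be an action of a (discrete) group $\Gamma$ on a Polish space $X$ by Borel automorphisms, i.e. for every $\gamma\in\Gamma$ the map $x\mapsto\gamma\cdot_a x$ is Borel. Suppose that $a$ is nonamenable, i.e. there is no finitely additive probability measure, defined on all subsets of $X$, that is invariant under $a$. Then there is an action $b$ of the free group $\mathbb{F}_2$ on $X$ such that: 1. $b$ is free: if $\delta\cdot_b x=x$ for some $x\in X$, then $\delta=1$; 2. $b$ is $a$-Lipschitz: for every $\delta\in\mathbb{F}_2$ there is a finite set $S\subset\Gamma$ such that for every $x\in X$ there is $\gamma\in S$ with $\delta\cdot_b x=\gamma\cdot_a x$; 3. $b$ is by Baire measurable automorphisms: for every $\delta\in\mathbb{F}_2$ and every Borel set $C\subset X$, the set $\{x\in X:\delta\cdot_b x\in C\}$ has the Baire property. Moreover, $b$ can be chosen so that there is a comeager Borel set $B\subset X$ which is invariant under $b$ and such that for every $\delta\in\mathbb{F}_2$ the restriction of $x\mapsto\delta\cdot_b x$ to $B$ is Borel. -/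

import Mathlib

/-- The action of `Γ` on `X` is amenable: there is a finitely additive probability measure,
defined on all subsets of `X`, which is invariant under the action. -/
def AmenableAction (Γ X : Type*) [Group Γ] [MulAction Γ X] : Prop :=
  ∃ m : Set X → ℝ,
    (∀ A, 0 ≤ m A) ∧
    m Set.univ = 1 ∧
    (∀ A B, Disjoint A B → m (A ∪ B) = m A + m B) ∧
    (∀ (γ : Γ) (A : Set X), m ((fun x => γ • x) '' A) = m A)

/-- The action of `Δ` on `X` is Lipschitz with respect to the action of `Γ` on `X`: every
`δ : Δ` moves points by elements of some finite subset of `Γ`. -/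
def LipschitzAction (Γ Δ X : Type*) [Group Γ] [Group Δ] [MulAction Γ X] [MulAction Δ X] : Prop :=
  ∀ δ : Δ, ∃ S : Finset Γ, ∀ x : X, ∃ γ ∈ S, δ • x = γ • x

/-- The action is free: only the identity has a fixed point. -/
def FreeAction (Δ X : Type*) [Group Δ] [MulAction Δ X] : Prop :=
  ∀ (δ : Δ) (x : X), δ • x = x → δ = 1

/-- A function is Baire measurable if the preimage of every Borel set has the Baire property. -/
def BaireMeasurableMap {X Y : Type*} [TopologicalSpace X] [TopologicalSpace Y]
    [MeasurableSpace Y] [BorelSpace Y] (f : X → Y) : Prop :=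
  ∀ B : Set Y, MeasurableSet B → BaireMeasurableSet (f ⁻¹' B)

/-! Nonamenability is the failure of Følner's condition, so powers of a finite set give a finite `S`
with `4 * |F| ≤ |S • F|` for all finite `F ⊆ X`. Join each point of `X × {0}` to its `S`-translates
in `X × {1, 2}`. This bipartite graph expands finite sets by the factor two, and a perfect matching
of it is a bijection `X ≃ X × Bool` moving points by `S`: a two-to-one map.

Hall's theorem alone gives no measurable matching, so the matching is built in stages
(`exists_measurable_matching`). Stage `n` matches the points of a very sparse set `A n`, each with a
partner whose removal, taken alone, keeps Hall's condition on its orbit. A finite connected piece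
that feels several removals at once must be large, so its surplus of neighbours pays for them; the
expansion factor only drops from `1 + 2 ^ (-n)` to `1 + 2 ^ (-(n + 1))` (`hallOn_remaining`). A
Baire category argument provides sparse Borel sets covering an invariant comeager set `B`, and off
`B` the axiom of choice provides the cover (`exists_discrete_seq_cover`). The construction then runs
on all of `X` at once, for the σ-algebra of sets whose trace on `B` is Borel.

The cycles of the two-to-one map are then rerouted to infinity (`exists_acyclic`). From an acyclic
two-to-one map one gets `X ≃ X × 4` and `X ≃ X × 3`, and with these the four letters of the free
group act so that every point has one parent and three children. The parent map is acyclic, so the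
Schreier graph is a forest and the action is free (`free_of_acyclic_parent`). Every map used moves
points by finitely many group elements, which gives the Lipschitz property. -/

/-! ### Baire category: sparse Borel sets that cover generically -/

section Genericity

open Set

/-- A countable family of measurable sets, indexed by a countable basis, that covers the space and
each of whose members meets its translates by `T` only in fixed points. -/
theorem exists_discrete_cover {Γ X : Type*} [Group Γ] [TopologicalSpace X] [T1Space X]
    [SecondCountableTopology X] [MeasurableSpace X] [BorelSpace X] [MulAction Γ X]
    (hBorel : ∀ γ : Γ, Measurable (fun x : X => γ • x))
    (hdiag : ∀ γ : Γ, MeasurableSet {x : X | γ • x = x}) (T : Finset Γ) :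
    ∃ D : TopologicalSpace.countableBasis X → Set X,
      (∀ k, MeasurableSet (D k)) ∧ (∀ k, ∀ x ∈ D k, ∀ γ ∈ T, γ • x ∈ D k → γ • x = x) ∧
      ∀ x, ∃ k, x ∈ D k := by
  classical
  refine ⟨fun k => {x | x ∈ k.1 ∧ ∀ γ ∈ T, γ • x ≠ x → γ • x ∉ k.1}, ?_, ?_, ?_⟩
  · rintro ⟨U, hU⟩
    have hUm : MeasurableSet U :=
      ((TopologicalSpace.isBasis_countableBasis X).isOpen hU).measurableSet
    have : {x : X | x ∈ U ∧ ∀ γ ∈ T, γ • x ≠ x → γ • x ∉ U} =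
        U ∩ ⋂ γ ∈ T, ({x : X | γ • x = x} ∪ ((fun x => γ • x) ⁻¹' U)ᶜ) := by
      ext x
      simp only [mem_ofPred_eq, mem_inter_iff, mem_iInter, mem_union, mem_compl_iff, mem_preimage]
      refine and_congr_right fun _ => forall₂_congr fun γ _ => ?_
      tauto
    simp only [this]
    refine hUm.inter (Finset.measurableSet_biInter _ fun γ _ => ?_)
    exact (hdiag γ).union (hBorel γ hUm).compl
  · rintro k x ⟨_, h⟩ γ hγ ⟨h', _⟩
    by_contra hne
    exact h γ hγ hne h'
  · intro x
    have hfin : ((T.image fun γ => γ • x).erase x : Set X).Finite := Finset.finite_toSet _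
    have hopen : IsOpen ((((T.image fun γ => γ • x).erase x : Finset X) : Set X)ᶜ) :=
      hfin.isClosed.isOpen_compl
    obtain ⟨U, hU, hxU, hsub⟩ := (TopologicalSpace.isBasis_countableBasis X).exists_subset_of_mem_open
      (show x ∈ _ by simp) hopen
    refine ⟨⟨U, hU⟩, hxU, fun γ hγ hne hmem => ?_⟩
    exact hsub hmem (by simpa using ⟨⟨γ, hγ, rfl⟩, hne⟩)

/-- Discrete Borel sets all of whose translates have comeager union. -/
theorem exists_discrete_seq_residual {Γ X : Type*} [Group Γ] [Countable Γ] [TopologicalSpace X]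
    [PolishSpace X] [MeasurableSpace X] [BorelSpace X] [MulAction Γ X]
    (hBorel : ∀ γ : Γ, Measurable (fun x : X => γ • x)) (T : ℕ → Finset Γ) :
    ∃ A : ℕ → Set X, (∀ n, MeasurableSet (A n)) ∧
      (∀ n, ∀ x ∈ A n, ∀ γ ∈ T n, γ • x ∈ A n → γ • x = x) ∧
      ∀ γ : Γ, {x | γ • x ∈ ⋃ n, A n} ∈ residual X := by
  classical
  rcases isEmpty_or_nonempty X with hX | hX
  · exact ⟨fun _ => ∅, fun _ => .empty, by simp, fun γ => by
      rw [Set.eq_univ_of_forall (s := {x : X | _}) (fun x => (hX.false x).elim)]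
      exact Filter.univ_mem⟩
  have hdiag : ∀ γ : Γ, MeasurableSet {x : X | γ • x = x} := fun γ =>
    measurableSet_eq_fun (hBorel γ) measurable_id
  have hb := TopologicalSpace.isBasis_countableBasis X
  have : Countable (TopologicalSpace.countableBasis X) :=
    (TopologicalSpace.countable_countableBasis X).to_subtype
  have : Nonempty (TopologicalSpace.countableBasis X) := by
    obtain ⟨U, hU, -⟩ := hb.exists_subset_of_mem_open (mem_univ hX.some) isOpen_univ
    exact ⟨⟨U, hU⟩⟩
  obtain ⟨enum, henum⟩ := exists_surjective_nat (Γ × TopologicalSpace.countableBasis X)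
  choose D hDm hDd hDc using fun n => exists_discrete_cover hBorel hdiag (T n)
  -- The `n`-th set serves one pair `(γ, U)`: countably many sets `D n k` cover `X`, so one of them
  -- pulls back under `γ` to a set nonmeager in `U`.
  have key : ∀ n, ∃ k, ¬ IsMeagre {x | x ∈ (enum n).2.1 ∧ (enum n).1 • x ∈ D n k} := by
    intro n
    by_contra! hcon
    have h1 := isMeagre_iUnion hcon
    refine not_isMeagre_of_isOpen (hb.isOpen (enum n).2.2)
      (TopologicalSpace.nonempty_of_mem_countableBasis (enum n).2.2) (h1.mono fun x hx => ?_)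
    obtain ⟨k, hk⟩ := hDc n ((enum n).1 • x)
    exact mem_iUnion.2 ⟨k, hx, hk⟩
  choose k hk using key
  refine ⟨fun n => D n (k n), fun n => hDm n _, fun n => hDd n _, fun γ => ?_⟩
  set G : Set X := {x | γ • x ∈ ⋃ n, D n (k n)} with hG
  have hGm : MeasurableSet G := hBorel γ (MeasurableSet.iUnion fun n => hDm n _)
  obtain ⟨O, hO, hGO⟩ := hGm.compl.residualEq_isOpen
  rw [Filter.eventuallyEq_set] at hGO
  -- If the complement of `G` were comeager in a nonempty open set, it would be so in some basic
  -- `U`, against the choice made for `(γ, U)`.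
  have hOe : O = ∅ := by
    by_contra hne
    obtain ⟨y, hy⟩ := nonempty_iff_ne_empty.2 hne
    obtain ⟨U, hU, hyU, hUO⟩ := hb.exists_subset_of_mem_open hy hO
    obtain ⟨n, hn⟩ := henum (γ, ⟨U, hU⟩)
    refine hk n ?_
    rw [hn]
    show _ ∈ residual X
    filter_upwards [hGO] with x hx hx'
    exact (hx.2 (hUO hx'.1)) (mem_iUnion.2 ⟨n, hx'.2⟩)
  filter_upwards [hGO] with x hx
  by_contra hx'
  simpa [hOe] using hx.1 hx'

/-- Measurable selection from countably many measurable conditions. -/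
theorem exists_measurable_choice {Λ Z : Type*} [Countable Λ] [Nonempty Λ] [MeasurableSpace Z]
    (D : Λ → Set Z) (hD : ∀ l, MeasurableSet (D l)) :
    ∃ g : Z → Λ, (∀ l, MeasurableSet {z | g z = l}) ∧ ∀ z, (∃ l, z ∈ D l) → z ∈ D (g z) := by
  classical
  obtain ⟨f, hf⟩ := exists_surjective_nat Λ
  let D' : ℕ → Set Z := fun n => D (f n)
  let N : Z → ℕ := fun z => if h : ∃ n, z ∈ D' n then Nat.find h else 0
  refine ⟨fun z => f (N z), fun l => ?_, fun z ⟨l, hl⟩ => ?_⟩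
  · have hN : ∀ n, MeasurableSet {z | N z = n} := by
      intro n
      -- Points satisfying no condition get the default `0`, which accounts for the second set.
      have : {z | N z = n} = (D' n \ ⋃ m ∈ Finset.range n, D' m) ∪
          {z | n = 0 ∧ z ∉ ⋃ m, D' m} := by
        ext z
        by_cases h : ∃ n, z ∈ D' n
        · simp only [N, h, dif_pos, mem_ofPred_eq, Nat.find_eq_iff]
          simp [h]
        · have h' : ∀ n, z ∉ D' n := by simpa using h
          simp only [N, h, mem_ofPred_eq]
          simp [h', eq_comm]
      rw [this]
      refine ((hD _).diff (Finset.measurableSet_biUnion _ fun m _ => hD _)).union ?_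
      exact (MeasurableSet.const _).inter (MeasurableSet.iUnion fun m => hD (f m)).compl
    have : {z | f (N z) = l} = ⋃ n ∈ {n | f n = l}, {z | N z = n} := by
      ext z; simp
    rw [this]
    exact MeasurableSet.biUnion (Set.to_countable _) fun n _ => hN n
  · obtain ⟨n, rfl⟩ := hf l
    have h : ∃ n, z ∈ D' n := ⟨n, hl⟩
    have := Nat.find_spec h
    simpa [N, h, D'] using this

/-- The sets of `exists_discrete_seq_residual` cover the whole space, once they are changed on the
complement of a comeager invariant Borel set. -/
theorem exists_discrete_seq_cover {Γ X : Type*} [Group Γ] [Countable Γ] [TopologicalSpace X]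
    [PolishSpace X] [MeasurableSpace X] [BorelSpace X] [MulAction Γ X]
    (hBorel : ∀ γ : Γ, Measurable (fun x : X => γ • x)) (T : ℕ → Finset Γ) :
    ∃ (B : Set X) (A : ℕ → Set X), MeasurableSet B ∧ B ∈ residual X ∧
      (∀ γ : Γ, ∀ x, γ • x ∈ B ↔ x ∈ B) ∧ (∀ n, MeasurableSet (A n ∩ B)) ∧
      (∀ n, ∀ x ∈ A n, ∀ γ ∈ T n, γ • x ∈ A n → γ • x = x) ∧ ∀ x, ∃ n, x ∈ A n := by
  classical
  obtain ⟨A, hAm, hAd, hAr⟩ := exists_discrete_seq_residual hBorel T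
  obtain ⟨enum, henum⟩ := exists_surjective_nat Γ
  set B : Set X := ⋂ γ : Γ, {x | γ • x ∈ ⋃ n, A n} with hB
  have hinv : ∀ γ : Γ, ∀ x, x ∈ B → γ • x ∈ B := by
    intro γ x hx
    rw [hB, mem_iInter] at hx ⊢
    intro κ
    have := hx (κ * γ)
    simpa [mul_smul] using this
  have hiff : ∀ γ : Γ, ∀ x, γ • x ∈ B ↔ x ∈ B := fun γ x =>
    ⟨fun h => by simpa using hinv γ⁻¹ _ h, hinv γ x⟩
  let rep : X → X := fun x => (Quotient.mk (MulAction.orbitRel Γ X) x).out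
  have hrep : ∀ x, ∃ γ : Γ, γ • rep x = x := fun x => by
    let := MulAction.orbitRel Γ X
    exact MulAction.orbitRel_apply.1 (Setoid.symm (Quotient.mk_out x))
  have hrepinv : ∀ (γ : Γ) x, rep (γ • x) = rep x := fun γ x => by
    have : (Quotient.mk (MulAction.orbitRel Γ X) (γ • x)) = Quotient.mk _ x :=
      Quotient.sound (MulAction.orbitRel_apply.2 ⟨γ, rfl⟩)
    simp only [rep, this]
  -- Off `B`, each new set has at most one point in each orbit, namely `enum n` applied to the
  -- representative, so it is discrete for every `T n`.
  refine ⟨B, fun n => (A n ∩ B) ∪ {x | x ∉ B ∧ x = enum n • rep x},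
    .iInter fun γ => hBorel γ (.iUnion hAm), (countable_iInter_mem).2 hAr, hiff, fun n => ?_,
    fun n x hx γ hγ hx' => ?_, fun x => ?_⟩
  · have : ((A n ∩ B) ∪ {x | x ∉ B ∧ x = enum n • rep x}) ∩ B = A n ∩ B := by
      ext x
      simp only [mem_inter_iff, mem_union, mem_ofPred_eq]
      tauto
    rw [this]
    exact (hAm n).inter (.iInter fun γ => hBorel γ (.iUnion hAm))
  · rcases hx with hx | hx
    · have h2 : γ • x ∈ B := hinv γ x hx.2
      exact hAd n x hx.1 γ hγ (hx'.resolve_right fun h => h.1 h2).1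
    · have h2 : γ • x ∉ B := fun h => hx.1 ((hiff γ x).1 h)
      have h3 := (hx'.resolve_left fun h => h2 h.2).2
      rw [hrepinv] at h3
      rw [h3]; exact hx.2.symm
  · by_cases hx : x ∈ B
    · have h1 := mem_iInter.1 hx 1
      obtain ⟨n, hn⟩ : ∃ n, x ∈ A n := by simpa using h1
      exact ⟨n, Or.inl ⟨hn, hx⟩⟩
    · obtain ⟨γ, hγ⟩ := hrep x
      obtain ⟨n, rfl⟩ := henum γ
      exact ⟨n, Or.inr ⟨hx, hγ.symm⟩⟩

end Genericity

/-! ### Nonamenability gives expansion -/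

section Expansion

open Set Filter Topology Pointwise

/-- An action that satisfies Følner's condition is amenable. -/
theorem amenableAction_of_folner {Γ X : Type*} [Group Γ] [MulAction Γ X] [DecidableEq Γ]
    [DecidableEq X]
    (h : ∀ (S : Finset Γ) (n : ℕ), ∃ F : Finset X, F.Nonempty ∧
      (n + 1) * ((S • F).card) ≤ (n + 2) * F.card) : AmenableAction Γ X := by
  classical
  choose F hne hF using h
  let ι := Finset Γ × ℕ
  let U : Ultrafilter ι := Ultrafilter.of atTop
  have hU : (U : Filter ι) ≤ atTop := Ultrafilter.of_le _
  -- The invariant mean is the ultralimit of the proportion of the Følner set lying in `A`.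
  let m : Set X → ι → ℝ := fun A i => ((F i.1 i.2).filter (· ∈ A)).card / (F i.1 i.2).card
  have hpos : ∀ i : ι, (0 : ℝ) < (F i.1 i.2).card := fun i => by
    exact_mod_cast (hne i.1 i.2).card_pos
  have hmem : ∀ A i, m A i ∈ Icc (0 : ℝ) 1 := fun A i =>
    ⟨by positivity, div_le_one_of_le₀ (by exact_mod_cast Finset.card_filter_le _ _) (hpos i).le⟩
  have hlim : ∀ A, ∃ a ∈ Icc (0 : ℝ) 1, Tendsto (m A) U (𝓝 a) := fun A =>
    (isCompact_Icc).ultrafilter_le_nhds (U.map (m A))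
      (le_principal_iff.2 (Filter.mem_map.2 (univ_mem' (hmem A))))
  choose μ hμ hlim using hlim
  refine ⟨μ, fun A => (hμ A).1, ?_, fun A B hAB => ?_, fun γ A => ?_⟩
  · refine tendsto_nhds_unique (hlim univ) ?_
    have : m univ = fun _ => 1 := by
      funext i
      simp [m, (hpos i).ne']
    rw [this]; exact tendsto_const_nhds
  · refine tendsto_nhds_unique (hlim _) ?_
    have : m (A ∪ B) = fun i => m A i + m B i := by
      funext i
      simp only [m, ← add_div, mem_union, Finset.filter_or]
      rw [Finset.card_union_of_disjoint]
      · push_cast; rfl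
      · exact Finset.disjoint_filter.2 fun x _ hA hB => disjoint_left.1 hAB hA hB
    rw [this]; exact (hlim A).add (hlim B)
  · have hbound : ∀ (γ : Γ) (A : Set X) (i : ι), 1 ∈ i.1 → γ⁻¹ ∈ i.1 →
        m ((fun x => γ • x) '' A) i ≤ m A i + 1 / (i.2 + 1 : ℝ) := by
      intro γ A i h1 hγ
      set E := F i.1 i.2 with hE
      -- Pulled back by `γ⁻¹`, a point of `E` in `γ • A` lands in `A`, either inside `E` or in the
      -- boundary `i.1 • E \ E`, which has at most `|E| / (i.2 + 1)` points.
      have hc : ((E.filter (· ∈ (fun x => γ • x) '' A)).card) ≤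
          (E.filter (· ∈ A)).card + ((i.1 • E).card - E.card) := by
        have hsub : E ⊆ i.1 • E := fun x hx => by
          simpa using Finset.smul_mem_smul h1 hx
        rw [← Finset.card_sdiff_of_subset hsub, ← Finset.card_image_of_injective _
          (MulAction.injective γ⁻¹)]
        refine (Finset.card_le_card fun y hy => ?_).trans (Finset.card_union_le _ _)
        obtain ⟨x, hx, rfl⟩ := Finset.mem_image.1 hy
        obtain ⟨hxE, a, ha, rfl⟩ := Finset.mem_filter.1 hx
        have hm : a ∈ i.1 • E := by simpa using Finset.smul_mem_smul hγ hxE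
        simp only [inv_smul_smul]
        by_cases haE : a ∈ E
        · exact Finset.mem_union_left _ (Finset.mem_filter.2 ⟨haE, ha⟩)
        · exact Finset.mem_union_right _ (Finset.mem_sdiff.2 ⟨hm, haE⟩)
      have hle : E.card ≤ (i.1 • E).card := Finset.card_le_card fun x hx => by
        simpa using Finset.smul_mem_smul h1 hx
      have hF' : ((i.2 : ℝ) + 1) * ((i.1 • E).card) ≤ (i.2 + 2) * E.card := by
        exact_mod_cast hF i.1 i.2
      have hc' : (((E.filter (· ∈ (fun x => γ • x) '' A)).card : ℕ) : ℝ) ≤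
          (E.filter (· ∈ A)).card + (((i.1 • E).card : ℝ) - E.card) := by
        rw [← Nat.cast_sub hle]; exact_mod_cast hc
      have hE0 : (0 : ℝ) < E.card := hpos i
      have hn : (0 : ℝ) < (i.2 : ℝ) + 1 := by positivity
      simp only [m, ← hE]
      rw [div_add_div _ _ hE0.ne' hn.ne', div_le_div_iff₀ hE0 (by positivity)]
      nlinarith [mul_le_mul_of_nonneg_left hc' hn.le]
    have hev : ∀ γ : Γ, ∀ᶠ i : ι in U, 1 ∈ i.1 ∧ γ ∈ i.1 ∧ γ⁻¹ ∈ i.1 := fun γ => by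
      refine hU ((eventually_ge_atTop (({1, γ, γ⁻¹} : Finset Γ), 0)).mono fun i hi => ?_)
      have := hi.1
      exact ⟨this (by simp), this (by simp), this (by simp)⟩
    have hz : Tendsto (fun i : ι => 1 / ((i.2 : ℝ) + 1)) U (𝓝 0) := by
      refine (tendsto_one_div_add_atTop_nhds_zero_nat (𝕜 := ℝ)).comp ?_
      refine Tendsto.mono_left ?_ hU
      rw [← prod_atTop_atTop_eq]; exact tendsto_snd
    have hle : ∀ (γ : Γ) (A : Set X), μ ((fun x => γ • x) '' A) ≤ μ A := fun γ A => by
      have := (hlim A).add hz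
      rw [add_zero] at this
      exact le_of_tendsto_of_tendsto (hlim _) this
        ((hev γ).mono fun i hi => hbound γ A i hi.1 hi.2.2)
    refine le_antisymm (hle γ A) ?_
    have := hle γ⁻¹ ((fun x => γ • x) '' A)
    rwa [image_image, show (fun x : X => γ⁻¹ • γ • x) = id from funext fun x => by simp,
      image_id] at this

/-- A nonamenable action expands all finite sets by a fixed finite subset of the group. -/
theorem exists_expanding_of_not_amenableAction {Γ X : Type*} [Group Γ] [MulAction Γ X]
    [DecidableEq Γ] [DecidableEq X] (h : ¬ AmenableAction Γ X) (K : ℕ) :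
    ∃ S : Finset Γ, ∀ F : Finset X, K * F.card ≤ (S • F).card := by
  have h1 := mt amenableAction_of_folner h
  push Not at h1
  obtain ⟨S, n, hS⟩ := h1
  have hS' : ∀ F : Finset X, (n + 2) * F.card ≤ (n + 1) * (S • F).card := fun F => by
    rcases F.eq_empty_or_nonempty with rfl | hF
    · simp
    · exact (hS F hF).le
  have hpow : ∀ (k : ℕ) (F : Finset X), (n + 2) ^ k * F.card ≤ (n + 1) ^ k * (S ^ k • F).card := by
    intro k
    induction k with
    | zero => intro F; simp
    | succ k ih =>
      intro F
      calc (n + 2) ^ (k + 1) * F.card = (n + 2) ^ k * ((n + 2) * F.card) := by ring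
        _ ≤ (n + 2) ^ k * ((n + 1) * (S • F).card) := Nat.mul_le_mul_left _ (hS' F)
        _ = (n + 1) * ((n + 2) ^ k * (S • F).card) := by ring
        _ ≤ (n + 1) * ((n + 1) ^ k * (S ^ k • S • F).card) := Nat.mul_le_mul_left _ (ih _)
        _ = (n + 1) ^ (k + 1) * (S ^ (k + 1) • F).card := by
          rw [pow_succ S, mul_smul]; ring
  -- The factor `(n + 2) / (n + 1)` exceeds one, so a power of it passes `K`.
  have hgrow : ∃ k : ℕ, K * (n + 1) ^ k ≤ (n + 2) ^ k := by
    have hlt : (1 : ℝ) < (n + 2) / (n + 1) := by rw [one_lt_div (by positivity)]; linarith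
    obtain ⟨k, hk⟩ := pow_unbounded_of_one_lt (K : ℝ) hlt
    refine ⟨k, ?_⟩
    rw [div_pow, lt_div_iff₀ (by positivity)] at hk
    exact_mod_cast hk.le
  obtain ⟨k, hk⟩ := hgrow
  refine ⟨S ^ k, fun F => ?_⟩
  have := hpow k F
  have h2 : (n + 1) ^ k * (K * F.card) ≤ (n + 1) ^ k * (S ^ k • F).card := by
    calc _ = (K * (n + 1) ^ k) * F.card := by ring
      _ ≤ (n + 2) ^ k * F.card := by gcongr
      _ ≤ _ := this
  exact Nat.le_of_mul_le_mul_left h2 (by positivity)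

end Expansion

/-! ### Freeness from an acyclic parent map -/

section Freeness

open Set Function

/-- A letter of the free group on `ι`, acting through permutations `α i`. -/
def letterAct {ι X : Type*} (α : ι → Equiv.Perm X) (l : ι × Bool) : Equiv.Perm X :=
  cond l.2 (α l.1) (α l.1)⁻¹

theorem lift_mk_eq_prod {ι X : Type*} (α : ι → Equiv.Perm X) (L : List (ι × Bool)) :
    FreeGroup.lift α (FreeGroup.mk L) = (L.map (letterAct α)).prod :=
  FreeGroup.lift_mk

/-- Along a reduced word whose first letter does not point to the parent, each letter leads from a
point to one of its children. -/
theorem descend_of_isReduced {ι X : Type*} (α : ι → Equiv.Perm X) (d : X → ι × Bool)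
    (hd : ∀ l x, d x ≠ (l.1, !l.2) → d (letterAct α l x) = l) (P : X → X)
    (hP : ∀ x, letterAct α (d x) (P x) = x) (L : List (ι × Bool)) (a : ι × Bool)
    (hL : FreeGroup.IsReduced (L ++ [a])) (x : X) (hx : d x ≠ (a.1, !a.2)) :
    d (((L ++ [a]).map (letterAct α)).prod x) = ((L ++ [a]).head (by simp)) ∧
      P^[L.length + 1] (((L ++ [a]).map (letterAct α)).prod x) = x := by
  have hPc : ∀ l x, d x ≠ (l.1, !l.2) → P (letterAct α l x) = x := fun l x h => by
    have := hP (letterAct α l x)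
    rw [hd l x h] at this
    exact (letterAct α l).injective this
  induction L with
  | nil => simpa using ⟨hd a x hx, hPc a x hx⟩
  | cons b L ih =>
    have hL' : FreeGroup.IsReduced (L ++ [a]) := hL.infix ⟨[b], [], by simp⟩
    obtain ⟨h1, h2⟩ := ih hL'
    have hb : d (((L ++ [a]).map (letterAct α)).prod x) ≠ (b.1, !b.2) := by
      rw [h1]
      intro h
      have hch := hL
      rw [List.cons_append, FreeGroup.IsReduced] at hch
      have hcons : L ++ [a] = (L ++ [a]).head (by simp) :: (L ++ [a]).tail :=
        (List.cons_head_tail _).symm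
      rw [hcons, List.isChain_cons_cons] at hch
      have := hch.1 (by rw [h])
      rw [h] at this
      simp at this
    constructor
    · simpa using hd b _ hb
    · rw [List.length_cons, iterate_succ_apply]
      have := hPc b _ hb
      simp only [List.cons_append, List.map_cons, List.prod_cons, Equiv.Perm.mul_apply]
      rw [this]
      exact h2

/-- If the Schreier graph is directed by an acyclic parent map, the action is free. -/
theorem free_of_acyclic_parent {ι X : Type*} [DecidableEq ι] (α : ι → Equiv.Perm X)
    (d : X → ι × Bool) (hd : ∀ l x, d x ≠ (l.1, !l.2) → d (letterAct α l x) = l) (P : X → X)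
    (hP : ∀ x, letterAct α (d x) (P x) = x) (hper : ∀ x, x ∉ periodicPts P)
    (w : FreeGroup ι) (x : X) (hw : FreeGroup.lift α w x = x) : w = 1 := by
  have key : ∀ L : List (ι × Bool), FreeGroup.IsCyclicallyReduced L → ∀ x,
      (L.map (letterAct α)).prod x = x → L = [] := by
    intro L hL x hx
    induction L using List.bidirectionalRec with
    | nil => rfl
    | singleton a =>
      exfalso
      -- If `a` leads from `x` to its parent, then `a⁻¹` sends both `P x` and `x` to `x`, so `P x =
      -- x`.
      by_cases h : d x = (a.1, !a.2)
      · have h2 : letterAct α (a.1, !a.2) x = x := by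
          have : letterAct α (a.1, !a.2) = (letterAct α a)⁻¹ := by
            rcases a with ⟨i, b⟩; cases b <;> simp [letterAct]
          rw [this, Equiv.Perm.inv_eq_iff_eq]; simpa using hx.symm
        have hPx := hP x
        rw [h] at hPx
        have : P x = x := (letterAct α (a.1, !a.2)).injective (hPx.trans h2.symm)
        exact hper x (mk_mem_periodicPts one_pos (by simpa [IsPeriodicPt, IsFixedPt] using this))
      · have := (descend_of_isReduced α d hd P hP [] a (by simp) x h).2
        rw [List.nil_append, hx] at this
        exact hper x (mk_mem_periodicPts (by simp) this)
    | cons_append a L b _ =>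
      exfalso
      have hred := (FreeGroup.isCyclicallyReduced_cons_append_iff.1 hL)
      -- The letter `b` acts first. If it points to the parent of `x`, the inverse word is used
      -- instead: it starts with `a⁻¹`, which does not point to the parent because the word is
      -- cyclically reduced. Either way the word only descends, and climbing back by `P` makes `x`
      -- periodic.
      by_cases h : d x = (b.1, !b.2)
      · have hred' : FreeGroup.IsReduced (FreeGroup.invRev (a :: L ++ [b])) := by
          rw [FreeGroup.isReduced_iff_reduce_eq, FreeGroup.reduce_invRev, hred.1.reduce_eq]
        have hinv : ((FreeGroup.invRev (a :: L ++ [b])).map (letterAct α)).prod x = x := by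
          rw [← lift_mk_eq_prod, ← FreeGroup.inv_mk, map_inv, lift_mk_eq_prod,
            Equiv.Perm.inv_eq_iff_eq]
          exact hx.symm
        have hform : FreeGroup.invRev (a :: L ++ [b]) =
            FreeGroup.invRev (L ++ [b]) ++ [(a.1, !a.2)] := by
          simp [FreeGroup.invRev]
        rw [hform] at hred' hinv
        have := (descend_of_isReduced α d hd P hP _ _ hred' x (by
          rw [h]
          intro h'
          simp only [Prod.mk.injEq, Bool.not_not] at h'
          have := hred.2 h'.1
          rw [this] at h'
          simpa using h'.2)).2
        rw [hinv] at this
        exact hper x (mk_mem_periodicPts (by simp) this)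
      · have := (descend_of_isReduced α d hd P hP _ _ hred.1 x h).2
        rw [List.cons_append, hx] at this
        exact hper x (mk_mem_periodicPts (by simp) this)
  -- A fixed point of `w` yields one of its cyclically reduced conjugate, which is therefore empty.
  set c := FreeGroup.reduceCyclically.conjugator w.toWord with hc
  set r := FreeGroup.reduceCyclically w.toWord with hr
  have hdec : w = FreeGroup.mk c * FreeGroup.mk r * (FreeGroup.mk c)⁻¹ := by
    rw [FreeGroup.inv_mk, FreeGroup.mul_mk, FreeGroup.mul_mk,
      FreeGroup.reduceCyclically.conj_conjugator_reduceCyclically, FreeGroup.mk_toWord]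
  have hr0 := key r (FreeGroup.reduceCyclically.isCyclicallyReduced FreeGroup.isReduced_toWord)
    ((FreeGroup.lift α (FreeGroup.mk c))⁻¹ x) (by
      rw [← lift_mk_eq_prod, Equiv.Perm.eq_inv_iff_eq]
      conv_rhs => rw [← hw, hdec]
      simp only [map_mul, map_inv, Equiv.Perm.mul_apply])
  rw [hdec, hr0, ← FreeGroup.one_eq_mk, mul_one, mul_inv_cancel]

end Freeness

/-! ### From an acyclic two-to-one map to a free action -/

section Letters

open Set Function

/-- The map `f` moves points by elements of a finite subset of `Γ`. -/
def FinitelyMoves (Γ : Type*) {X : Type*} [Group Γ] [MulAction Γ X] (f : X → X) : Prop :=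
  ∃ S : Finset Γ, ∀ x, ∃ γ ∈ S, f x = γ • x

namespace FinitelyMoves

variable {Γ X : Type*} [Group Γ] [MulAction Γ X]

protected theorem id : FinitelyMoves Γ (id : X → X) :=
  ⟨{1}, fun x => ⟨1, by simp⟩⟩

theorem comp {f g : X → X} (hf : FinitelyMoves Γ f) (hg : FinitelyMoves Γ g) :
    FinitelyMoves Γ (f ∘ g) := by
  classical
  obtain ⟨S, hS⟩ := hf
  obtain ⟨T, hT⟩ := hg
  refine ⟨Finset.image₂ (· * ·) S T, fun x => ?_⟩
  obtain ⟨γ, hγ, h1⟩ := hT x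
  obtain ⟨κ, hκ, h2⟩ := hS (g x)
  exact ⟨κ * γ, Finset.mem_image₂_of_mem hκ hγ, by rw [mul_smul, ← h1, ← h2]; rfl⟩

theorem iterate {f : X → X} (hf : FinitelyMoves Γ f) (N : ℕ) :
    ∃ S : Finset Γ, ∀ x, ∀ i ≤ N, ∃ γ ∈ S, f^[i] x = γ • x := by
  classical
  have h : ∀ i, FinitelyMoves Γ f^[i] := fun i => by
    induction i with
    | zero => exact FinitelyMoves.id
    | succ i ih => rw [iterate_succ]; exact ih.comp hf
  choose S hS using h
  refine ⟨(Finset.range (N + 1)).biUnion S, fun x i hi => ?_⟩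
  obtain ⟨γ, hγ, h⟩ := hS i x
  exact ⟨γ, Finset.mem_biUnion.2 ⟨i, by simpa [Nat.lt_succ_iff] using hi, hγ⟩, h⟩

/-- If `γ • g x = κ • x` is a common iterate, then `g x = (γ⁻¹ * κ) • x`; bounded heights leave
finitely many such pairs. -/
theorem of_iterate_eq {f g : X → X} (hf : FinitelyMoves Γ f) (N : ℕ)
    (h : ∀ x, ∃ i ≤ N, ∃ j ≤ N, f^[i] (g x) = f^[j] x) : FinitelyMoves Γ g := by
  classical
  obtain ⟨S, hS⟩ := hf.iterate N
  refine ⟨Finset.image₂ (fun a b => a⁻¹ * b) S S, fun x => ?_⟩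
  obtain ⟨i, hi, j, hj, hij⟩ := h x
  obtain ⟨γ, hγ, h1⟩ := hS (g x) i hi
  obtain ⟨κ, hκ, h2⟩ := hS x j hj
  refine ⟨γ⁻¹ * κ, Finset.mem_image₂_of_mem (f := fun a b => a⁻¹ * b) hγ hκ, ?_⟩
  rw [mul_smul, ← h2, ← hij, h1, inv_smul_smul]

end FinitelyMoves

theorem measurable_of_measurable_pieces {ι X Y : Type*} [Countable ι] [MeasurableSpace X]
    [MeasurableSpace Y] (p : X → ι) (hp : ∀ i, MeasurableSet {x | p x = i}) (f : ι → X → Y)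
    (hf : ∀ i, Measurable (f i)) : Measurable fun x => f (p x) x := by
  intro C hC
  have : (fun x => f (p x) x) ⁻¹' C = ⋃ i, {x | p x = i} ∩ f i ⁻¹' C := by
    ext x; simp
  rw [this]
  exact .iUnion fun i => (hp i).inter (hf i hC)

/-- The inverse of a letter. -/
def letterInv {ι : Type*} (l : ι × Bool) : ι × Bool := (l.1, !l.2)

@[simp] theorem letterInv_letterInv {ι : Type*} (l : ι × Bool) : letterInv (letterInv l) = l := by
  simp [letterInv]

section LetterMap

variable {X K : Type*} {L : Type*} [DecidableEq L] (inv : L → L) (E4 : X ≃ X × L) (E3 : X ≃ X × K)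
  (τ : ∀ l : L, {m : L // m ≠ inv l} ≃ K)

/-- The letter `l` maps all points without the label `inv l` onto the points with label `l`, and
acts on the points with label `inv l` as the inverse of the letter `inv l`. -/
def letterMap (l : L) (x : X) : X :=
  if h : (E4 x).2 ≠ inv l then E4.symm (E3.symm ((E4 x).1, τ l ⟨(E4 x).2, h⟩), l)
  else E4.symm ((E3 (E4 x).1).1, ((τ (inv l)).symm (E3 (E4 x).1).2).1)

variable {inv E4 E3 τ}

theorem label_letterMap {l : L} {x : X} (h : (E4 x).2 ≠ inv l) :
    (E4 (letterMap inv E4 E3 τ l x)).2 = l := by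
  simp [letterMap, h]

/-- The two branches of the definition are inverse to each other: a point without the label `inv l`
is sent to one labelled `l = inv (inv l)`, where `inv l` takes the second branch, and conversely. -/
theorem letterMap_inv (hinv : ∀ l, inv (inv l) = l) (l : L) (x : X) :
    letterMap inv E4 E3 τ (inv l) (letterMap inv E4 E3 τ l x) = x := by
  by_cases h : (E4 x).2 ≠ inv l
  · have hτ : ∀ l' (hl : l' = l), ((τ l').symm (τ l ⟨(E4 x).2, h⟩)).1 = (E4 x).2 := by
      rintro _ rfl; simp
    have h1 : letterMap inv E4 E3 τ l x = E4.symm (E3.symm ((E4 x).1, τ l ⟨(E4 x).2, h⟩), l) := by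
      simp [letterMap, h]
    rw [h1, letterMap, dif_neg (by simp [hinv])]
    simp only [Equiv.apply_symm_apply]
    rw [hτ _ (hinv l)]
    simp
  · push Not at h
    have hm := ((τ (inv l)).symm (E3 (E4 x).1).2).2
    have h1 : letterMap inv E4 E3 τ l x =
        E4.symm ((E3 (E4 x).1).1, ((τ (inv l)).symm (E3 (E4 x).1).2).1) := by
      simp [letterMap, h]
    rw [h1, letterMap, dif_pos (by simpa using hm)]
    simp only [Equiv.apply_symm_apply, Subtype.coe_eta, Prod.mk.eta, Equiv.symm_apply_apply]
    rw [← h, Prod.mk.eta, Equiv.symm_apply_apply]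

theorem measurable_letterMap [Countable L] [Countable K] [MeasurableSpace X]
    (h4 : Measurable fun x => (E4 x).1) (h4' : ∀ m, MeasurableSet {x | (E4 x).2 = m})
    (h4s : ∀ m, Measurable fun x => E4.symm (x, m))
    (h3 : Measurable fun x => (E3 x).1) (h3' : ∀ m, MeasurableSet {x | (E3 x).2 = m})
    (h3s : ∀ m, Measurable fun x => E3.symm (x, m)) (l : L) :
    Measurable (letterMap inv E4 E3 τ l) := by
  have hp : ∀ q : L × K, MeasurableSet {x | ((E4 x).2, (E3 (E4 x).1).2) = q} := by
    rintro ⟨m, k⟩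
    simp only [Prod.mk.injEq]
    exact (h4' m).inter (h4 (h3' k))
  refine measurable_of_measurable_pieces (fun x => ((E4 x).2, (E3 (E4 x).1).2)) hp
    (fun q x => if h : q.1 ≠ inv l then E4.symm (E3.symm ((E4 x).1, τ l ⟨q.1, h⟩), l)
      else E4.symm ((E3 (E4 x).1).1, ((τ (inv l)).symm q.2).1)) fun q => ?_
  by_cases h : q.1 ≠ inv l
  · simp only [h, ne_eq, not_false_eq_true, dif_pos]
    exact (h4s _).comp ((h3s _).comp h4)
  · simp only [h, dif_neg, not_false_eq_true]
    exact (h4s _).comp (h3.comp h4)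

end LetterMap

section Cylinders

variable {X : Type*} (e : X ≃ X × Bool)

/-- Splitting a space in two pieces twice gives four pieces, labelled by letters. -/
def fourPieces : X ≃ X × (Fin 2 × Bool) :=
  ((e.trans (e.prodCongr (Equiv.refl Bool))).trans (Equiv.prodAssoc _ _ _)).trans
    ((Equiv.refl X).prodCongr (finTwoEquiv.symm.prodCongr (Equiv.refl Bool)))

theorem fourPieces_snd (x : X) :
    (fourPieces e x).2 = (finTwoEquiv.symm (e (e x).1).2, (e x).2) := rfl

/-- Splitting a space in two pieces and one of them in two again gives three pieces. -/
def threePieces : X ≃ X × Option Bool where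
  toFun x := if (e x).2 then ((e (e x).1).1, some (e (e x).1).2) else ((e x).1, none)
  invFun q := q.2.elim (e.symm (q.1, false)) fun i => e.symm (e.symm (q.1, i), true)
  left_inv x := by
    cases h : (e x).2
    · simp [h, Equiv.symm_apply_eq, Prod.ext_iff]
    · simp [h, Equiv.symm_apply_eq, Prod.ext_iff]
  right_inv := by
    rintro ⟨x, _ | i⟩ <;> simp

theorem threePieces_fst (x : X) :
    (threePieces e x).1 = (e x).1 ∨ (threePieces e x).1 = (e (e x).1).1 := by
  by_cases h : (e x).2 = true <;> simp [threePieces, h]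

end Cylinders

/-- The letters act on a space with an acyclic two-to-one map. -/
theorem exists_freeAction_of_acyclic {Γ X : Type*} [Group Γ] [MulAction Γ X] [MeasurableSpace X]
    (e : X ≃ᵐ X × Bool) (hper : ∀ x, x ∉ periodicPts fun x => (e x).1)
    (hmov : FinitelyMoves Γ fun x => (e x).1) :
    ∃ b : MulAction (FreeGroup (Fin 2)) X,
      FreeAction (FreeGroup (Fin 2)) X ∧ LipschitzAction Γ (FreeGroup (Fin 2)) X ∧
      ∀ δ : FreeGroup (Fin 2), Measurable fun x : X => δ • x := by
  classical
  set φ : X → X := fun x => (e x).1 with hφ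
  have hφm : Measurable φ := measurable_fst.comp e.measurable
  have hbit : ∀ i, MeasurableSet {x | (e x).2 = i} := fun i =>
    (measurable_snd.comp e.measurable) (measurableSet_singleton i)
  have hc : ∀ i, Measurable fun x => e.symm (x, i) := fun i =>
    e.symm.measurable.comp measurable_prodMk_right
  let E4 := fourPieces e.toEquiv
  let E3 := threePieces e.toEquiv
  have hcard : ∀ l : Fin 2 × Bool,
      Fintype.card {m : Fin 2 × Bool // m ≠ letterInv l} = Fintype.card (Option Bool) := by
    decide
  let τ : ∀ l : Fin 2 × Bool, {m : Fin 2 × Bool // m ≠ letterInv l} ≃ Option Bool := fun l =>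
    Fintype.equivOfCardEq (hcard l)
  let act := letterMap letterInv E4 E3 τ
  have hactinv : ∀ l x, act (letterInv l) (act l x) = x :=
    letterMap_inv letterInv_letterInv
  let α : Fin 2 → Equiv.Perm X := fun i =>
    ⟨act (i, true), act (i, false), hactinv (i, true), hactinv (i, false)⟩
  have hletter : ∀ l x, letterAct α l x = act l x := by
    rintro ⟨i, _ | _⟩ x <;> rfl
  have hE4 : ∀ x, (E4 x).1 = φ (φ x) := fun _ => rfl
  have hE4s : ∀ x, φ (φ (E4.symm x)) = x.1 := fun x => by rw [← hE4]; simp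
  have hE3 : ∀ x, ∃ j ≤ 2, 1 ≤ j ∧ (E3 x).1 = φ^[j] x := fun x => by
    rcases threePieces_fst e.toEquiv x with h | h
    · exact ⟨1, by simp, le_rfl, h⟩
    · exact ⟨2, le_rfl, by simp, h⟩
  -- The parent of `x` in the tree is reached by the inverse of its label. Passing to it advances
  -- the grandparent `φ (φ x)` by one or two steps of `φ`; the upper bound gives bounded motion and
  -- the lower bound acyclicity.
  have hparent : ∀ x, ∃ j ≤ 2, 1 ≤ j ∧
      φ (φ (act (letterInv (E4 x).2) x)) = φ^[j] (φ (φ x)) := fun x => by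
    obtain ⟨j, hj, hj1, h⟩ := hE3 (φ (φ x))
    refine ⟨j, hj, hj1, ?_⟩
    rw [← h]
    simp only [act, letterMap, letterInv_letterInv, ne_eq, not_true_eq_false, dite_false, hE4s]
    rw [hE4]
  have hmovact : ∀ l, FinitelyMoves Γ (act l) := fun l => by
    -- Two steps come from the label of `E4` and at most two from `E3`.
    refine hmov.of_iterate_eq 4 fun x => ?_
    by_cases h : (E4 x).2 = letterInv l
    · obtain ⟨j, hj, -, hx⟩ := hparent x
      rw [h, letterInv_letterInv] at hx
      exact ⟨2, by simp, j + 2, by omega, by rw [iterate_add_apply]; exact hx⟩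
    · obtain ⟨j, hj, -, hx⟩ := hE3 (E3.symm ((E4 x).1, τ l ⟨(E4 x).2, h⟩))
      refine ⟨j + 2, by omega, 2, by simp, ?_⟩
      rw [iterate_add_apply]
      have : φ^[2] (act l x) = E3.symm ((E4 x).1, τ l ⟨(E4 x).2, h⟩) := by
        simp only [act, letterMap, ne_eq, h, not_false_eq_true, dite_true]
        exact hE4s _
      rw [this, ← hx, Equiv.apply_symm_apply]
      exact hE4 x
  have hmeas : ∀ l, Measurable (act l) := by
    refine measurable_letterMap (hφm.comp hφm) ?_ ?_ ?_ ?_ ?_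
    · rintro ⟨i, b⟩
      have : {x | (E4 x).2 = (i, b)} =
          φ ⁻¹' {x | (e x).2 = finTwoEquiv i} ∩ {x | (e x).2 = b} := by
        ext x
        simp only [E4, fourPieces_snd, Prod.mk.injEq, mem_ofPred_eq, mem_inter_iff, mem_preimage,
          Equiv.symm_apply_eq]
        rfl
      rw [this]
      exact (hφm (hbit _)).inter (hbit _)
    · exact fun m => (hc m.2).comp (hc _)
    · have : (fun x => (E3 x).1) = fun x => if (e x).2 = true then φ (φ x) else φ x := by
        funext x
        by_cases h : (e x).2 = true <;> simp [E3, threePieces, h, φ]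
      rw [this]
      exact Measurable.ite (hbit true) (hφm.comp hφm) hφm
    · rintro (_ | i)
      · have : {x | (E3 x).2 = none} = {x | (e x).2 = false} := by
          ext x
          by_cases h : (e x).2 = true <;> simp [E3, threePieces, h]
        rw [this]; exact hbit _
      · have : {x | (E3 x).2 = some i} = {x | (e x).2 = true} ∩ φ ⁻¹' {x | (e x).2 = i} := by
          ext x
          by_cases h : (e x).2 = true <;> simp [E3, threePieces, h, φ]
        rw [this]; exact (hbit _).inter (hφm (hbit _))
    · rintro (_ | i)
      · exact hc false
      · exact (hc true).comp (hc i)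
  have hfree : ∀ (w : FreeGroup (Fin 2)) (x : X), FreeGroup.lift α w x = x → w = 1 := by
    refine free_of_acyclic_parent α (fun x => (E4 x).2) ?_ (fun x => act (letterInv (E4 x).2) x)
      ?_ ?_
    · intro l x h
      rw [hletter]
      exact label_letterMap h
    · intro x
      rw [hletter]
      have := hactinv (letterInv (E4 x).2) x
      rwa [letterInv_letterInv] at this
    · set P : X → X := fun x => act (letterInv (E4 x).2) x with hP
      rintro x ⟨n, hn, hx⟩
      -- `n` steps of `P` become at least `n` steps of `φ`, so a cycle of `P` would give a cycle of
      -- `φ`.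
      have key : ∀ n, ∃ J ≥ n, φ (φ (P^[n] x)) = φ^[J] (φ (φ x)) := by
        intro n
        induction n with
        | zero => exact ⟨0, le_rfl, rfl⟩
        | succ n ih =>
          obtain ⟨J, hJ, h⟩ := ih
          obtain ⟨j, -, hj, h'⟩ := hparent (P^[n] x)
          refine ⟨j + J, by omega, ?_⟩
          rw [iterate_succ_apply', iterate_add_apply, ← h]
          exact h'
      obtain ⟨J, hJ, h⟩ := key n
      rw [hx] at h
      exact hper (φ (φ x)) ⟨J, by omega, h.symm⟩
  refine ⟨MulAction.compHom X (FreeGroup.lift α), fun w x h => hfree w x h, fun δ => ?_,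
    fun δ => ?_⟩
  · change FinitelyMoves Γ fun x => FreeGroup.lift α δ x
    induction δ using FreeGroup.induction_on with
    | C1 => rw [map_one]; exact FinitelyMoves.id
    | of i => simp only [FreeGroup.lift_apply_of]; exact hmovact (i, true)
    | inv_of i _ => simp only [map_inv, FreeGroup.lift_apply_of]; exact hmovact (i, false)
    | mul x y hx hy => simp only [map_mul, Equiv.Perm.mul_apply]; exact hx.comp hy
  · change Measurable fun x => FreeGroup.lift α δ x
    induction δ using FreeGroup.induction_on with
    | C1 => rw [map_one]; exact measurable_id
    | of i => simp only [FreeGroup.lift_apply_of]; exact hmeas (i, true)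
    | inv_of i _ => simp only [map_inv, FreeGroup.lift_apply_of]; exact hmeas (i, false)
    | mul x y hx hy => simp only [map_mul, Equiv.Perm.mul_apply]; exact hx.comp hy

end Letters

/-! ### Rerouting the cycles of a two-to-one map -/

section Cycles

open Set Function

section Surgery

variable {X : Type*} [MeasurableSpace X] (e : X ≃ᵐ X × Bool)

/-- The two-to-one map. -/
def parent (x : X) : X := (e x).1

/-- The children of a point. -/
def child (i : Bool) (x : X) : X := e.symm (x, i)

@[simp] theorem parent_child (i : Bool) (x : X) : parent e (child e i x) = x := by
  simp [parent, child]

theorem measurable_parent : Measurable (parent e) := measurable_fst.comp e.measurable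

theorem measurable_child (i : Bool) : Measurable (child e i) :=
  e.symm.measurable.comp measurable_prodMk_right

theorem child_injective2 {i j : Bool} {x y : X} (h : child e i x = child e j y) :
    i = j ∧ x = y := by
  have := e.symm.injective h
  simp only [Prod.mk.injEq] at this
  exact this.symm

open Classical in
/-- A child that is not periodic. -/
noncomputable def offChild (x : X) : X :=
  if child e false x ∈ periodicPts (parent e) then child e true x else child e false x

@[simp] theorem parent_offChild (x : X) : parent e (offChild e x) = x := by
  unfold offChild; split <;> simp

theorem parent_mem_periodicPts {x : X} (h : x ∈ periodicPts (parent e)) :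
    parent e x ∈ periodicPts (parent e) := by
  obtain ⟨n, hn, hx⟩ := h
  exact ⟨n, hn, hx.apply_iterate 1⟩

theorem eq_of_parent_eq {x y : X} (hx : x ∈ periodicPts (parent e))
    (hy : y ∈ periodicPts (parent e)) (h : parent e x = parent e y) : x = y :=
  (bijOn_periodicPts (f := parent e)).injOn hx hy h

/-- The map is injective on periodic points, so the two children of a point are not both periodic.
-/
theorem offChild_notMem (x : X) : offChild e x ∉ periodicPts (parent e) := by
  unfold offChild
  split
  · rename_i h
    intro h'
    have := eq_of_parent_eq e h h' (by simp)
    exact absurd (child_injective2 e this).1 (by simp)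
  · assumption

/-- The σ-algebra on `X` is arbitrary here; the injective measurable `ρ` is what makes equality of
measurable maps a measurable condition. -/
theorem measurableSet_periodicPts {ρ : X → ℝ} (hρ : Measurable ρ) (hρi : Injective ρ) :
    MeasurableSet (periodicPts (parent e)) := by
  have : periodicPts (parent e) = ⋃ n : ℕ, {x | ρ ((parent e)^[n + 1] x) = ρ x} := by
    ext x
    simp only [mem_iUnion, mem_ofPred_eq, hρi.eq_iff]
    constructor
    · rintro ⟨n, hn, hx⟩
      exact ⟨n - 1, by rw [Nat.sub_add_cancel hn]; exact hx⟩
    · rintro ⟨n, hx⟩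
      exact ⟨n + 1, n.succ_pos, hx⟩
  rw [this]
  exact .iUnion fun n => measurableSet_eq_fun
    (hρ.comp ((measurable_parent e).iterate _)) hρ

theorem measurable_offChild {ρ : X → ℝ} (hρ : Measurable ρ) (hρi : Injective ρ) :
    Measurable (offChild e) := by
  classical
  exact Measurable.ite ((measurable_child e false) (measurableSet_periodicPts e hρ hρi))
    (measurable_child e true) (measurable_child e false)

/-- A ray that leaves the cycle of a periodic point. -/
noncomputable def ray : ℕ → X → X
  | 0, x => x
  | 1, x => offChild e x
  | n + 2, x => child e false (ray (n + 1) x)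

/-- The ray in reverse, followed by the siblings of its points. -/
noncomputable def line : ℤ → X → X
  | Int.ofNat 0, x => x
  | Int.ofNat (n + 1), x => child e true (ray e (n + 1) x)
  | Int.negSucc n, x => ray e (n + 1) x

theorem line_succ (n : ℕ) (x : X) : line e (n + 1) x = child e true (ray e (n + 1) x) := rfl

theorem line_neg (n : ℕ) (x : X) : line e (-n) x = ray e n x := by
  cases n <;> rfl

@[simp] theorem parent_ray_succ (n : ℕ) (x : X) : parent e (ray e (n + 1) x) = ray e n x := by
  cases n <;> simp [ray]

theorem iterate_parent_ray (n k : ℕ) (x : X) : (parent e)^[n] (ray e (n + k) x) = ray e k x := by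
  induction n with
  | zero => simp
  | succ n ih =>
    rw [iterate_succ_apply, show n + 1 + k = n + k + 1 by ring, parent_ray_succ, ih]

theorem ray_succ_notMem (n : ℕ) (x : X) : ray e (n + 1) x ∉ periodicPts (parent e) := by
  induction n with
  | zero => exact offChild_notMem e x
  | succ n ih =>
    intro h
    exact ih (by simpa using parent_mem_periodicPts e h)

/-- Climbing from the lower-indexed point reaches the periodic `x`, whereas every point of a ray
after its origin is nonperiodic. -/
theorem ray_inj {n k : ℕ} {x y : X} (hx : x ∈ periodicPts (parent e))
    (hy : y ∈ periodicPts (parent e)) (h : ray e n x = ray e k y) : n = k ∧ x = y := by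
  wlog hnk : n ≤ k generalizing n k x y
  · have := this hy hx h.symm (by omega)
    exact ⟨this.1.symm, this.2.symm⟩
  obtain ⟨m, rfl⟩ := Nat.exists_eq_add_of_le hnk
  have h' := congrArg (parent e)^[n] h
  rw [iterate_parent_ray, show ray e n x = ray e (n + 0) x from rfl, iterate_parent_ray] at h'
  cases m with
  | zero => exact ⟨rfl, h'⟩
  | succ m => exact absurd (h' ▸ hx) (ray_succ_notMem e m y)

theorem line_succ_notMem (n : ℕ) (x : X) : line e (n + 1) x ∉ periodicPts (parent e) := by
  intro h
  exact ray_succ_notMem e n x (by simpa [line_succ] using parent_mem_periodicPts e h)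

/-- From index two on, rays use `false` children and the positive half of a line `true` ones. The
point of index one may be either child, but its parent is periodic. -/
theorem line_succ_ne_ray {n k : ℕ} {x y : X} (hy : y ∈ periodicPts (parent e)) :
    line e (n + 1) x ≠ ray e k y := by
  intro h
  match k with
  | 0 => exact line_succ_notMem e n x (h ▸ hy)
  | 1 =>
    have h' := congrArg (parent e) h
    rw [line_succ, parent_child, parent_ray_succ] at h'
    exact ray_succ_notMem e n x (h' ▸ hy)
  | k + 2 => exact absurd (child_injective2 e (h : child e true _ = child e false _)).1 (by simp)

theorem int_cases (k : ℤ) : (∃ n : ℕ, k = n + 1) ∨ ∃ n : ℕ, k = -n := by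
  rcases k with n | n
  · cases n with
    | zero => exact Or.inr ⟨0, by simp⟩
    | succ n => exact Or.inl ⟨n, by simp⟩
  · exact Or.inr ⟨n + 1, by rw [Int.negSucc_eq]; push_cast; ring⟩

theorem line_inj {n k : ℤ} {x y : X} (hx : x ∈ periodicPts (parent e))
    (hy : y ∈ periodicPts (parent e)) (h : line e n x = line e k y) : n = k ∧ x = y := by
  rcases int_cases n with ⟨n, rfl⟩ | ⟨n, rfl⟩ <;> rcases int_cases k with ⟨k, rfl⟩ | ⟨k, rfl⟩
  · rw [line_succ, line_succ] at h
    obtain ⟨h1, h2⟩ := ray_inj e hx hy (child_injective2 e h).2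
    exact ⟨by exact_mod_cast h1, h2⟩
  · rw [line_neg] at h
    exact absurd h (line_succ_ne_ray e hy)
  · rw [line_neg] at h
    exact absurd h.symm (line_succ_ne_ray e hx)
  · rw [line_neg, line_neg] at h
    obtain ⟨h1, h2⟩ := ray_inj e hx hy h
    exact ⟨by rw [h1], h2⟩

theorem measurable_ray {ρ : X → ℝ} (hρ : Measurable ρ) (hρi : Injective ρ) (n : ℕ) :
    Measurable (ray e n) := by
  match n with
  | 0 => exact measurable_id
  | 1 => exact measurable_offChild e hρ hρi
  | n + 2 => exact (measurable_child e false).comp (measurable_ray hρ hρi (n + 1))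

theorem measurable_line {ρ : X → ℝ} (hρ : Measurable ρ) (hρi : Injective ρ) (k : ℤ) :
    Measurable (line e k) := by
  rcases int_cases k with ⟨n, rfl⟩ | ⟨n, rfl⟩
  · exact (measurable_child e true).comp (measurable_ray e hρ hρi (n + 1))
  · have : line e (-n) = ray e n := funext (line_neg e n)
    rw [this]; exact measurable_ray e hρ hρi n

theorem exists_iterate_line (k : ℤ) : ∃ n, ∀ x, (parent e)^[n] (line e k x) = x := by
  rcases int_cases k with ⟨n, rfl⟩ | ⟨n, rfl⟩
  · refine ⟨n + 2, fun x => ?_⟩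
    rw [iterate_succ_apply, line_succ, parent_child]
    simpa [ray] using iterate_parent_ray e (n + 1) 0 x
  · refine ⟨n, fun x => ?_⟩
    rw [line_neg]
    simpa [ray] using iterate_parent_ray e n 0 x

/-- A two-to-one map can be rerouted so that it has no periodic points. -/
theorem exists_acyclic {Γ : Type*} [Group Γ] [MulAction Γ X] {ρ : X → ℝ} (hρ : Measurable ρ)
    (hρi : Injective ρ) (hmov : FinitelyMoves Γ (parent e)) :
    ∃ e' : X ≃ᵐ X × Bool, (∀ x, x ∉ periodicPts (parent e')) ∧
      FinitelyMoves Γ (parent e') := by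
  classical
  set Q := periodicPts (parent e) with hQ
  -- On each cycle, the point of least `ρ` is where the cycle will be cut.
  let T : Set X := {x | x ∈ Q ∧ ∀ k, ρ x ≤ ρ ((parent e)^[k] x)}
  have hTm : MeasurableSet T := by
    have : T = Q ∩ ⋂ k, {x | ρ x ≤ ρ ((parent e)^[k] x)} := by ext x; simp [T]
    rw [this]
    exact (measurableSet_periodicPts e hρ hρi).inter (.iInter fun k =>
      measurableSet_le hρ (hρ.comp ((measurable_parent e).iterate k)))
  have hTQ : ∀ x ∈ T, x ∈ Q := fun x hx => hx.1
  have hreach : ∀ x ∈ Q, ∃ k, (parent e)^[k] x ∈ T := by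
    rintro x ⟨n, hn, hx⟩
    obtain ⟨k, hk, hmin⟩ := Finset.exists_min_image (Finset.range n)
      (fun k => ρ ((parent e)^[k] x)) ⟨0, by simpa using hn⟩
    refine ⟨k, ⟨n, hn, hx.apply_iterate k⟩, fun j => ?_⟩
    rw [← iterate_add_apply, ← hx.iterate_mod_apply (j + k)]
    exact hmin _ (Finset.mem_range.2 (Nat.mod_lt _ hn))
  let f : ℤ × T ↪ X := ⟨fun p => line e p.1 p.2.1, fun p q h => by
    obtain ⟨h1, h2⟩ := line_inj e (hTQ _ p.2.2) (hTQ _ q.2.2) h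
    exact Prod.ext h1 (Subtype.ext h2)⟩
  let σ : ℤ → Equiv.Perm X := fun s =>
    Equiv.Perm.viaEmbedding ((Equiv.addRight s).prodCongr (Equiv.refl T)) f
  have hσ : ∀ s k x, x ∈ T → σ s (line e k x) = line e (k + s) x := fun s k x hx =>
    Equiv.Perm.viaEmbedding_apply _ f (k, ⟨x, hx⟩)
  have hσ' : ∀ s x, (∀ k, ∀ t ∈ T, line e k t ≠ x) → σ s x = x := fun s x hx =>
    Equiv.Perm.viaEmbedding_apply_of_notMem _ f x (by
      rintro ⟨⟨k, t⟩, h⟩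
      exact hx k t t.2 h)
  have hdich : ∀ x, (∃ k, ∃ t ∈ T, line e k t = x) ∨ ∀ k, ∀ t ∈ T, line e k t ≠ x := fun x => by
    by_cases h : ∃ k, ∃ t ∈ T, line e k t = x
    · exact Or.inl h
    · push Not at h; exact Or.inr h
  have hσσ : ∀ s x, σ (-s) (σ s x) = x := fun s x => by
    rcases hdich x with ⟨k, t, ht, rfl⟩ | h
    · rw [hσ _ _ _ ht, hσ _ _ _ ht]; congr 1; ring
    · rw [hσ' s x h, hσ' _ x h]
  choose top htop using exists_iterate_line e
  have hσm : ∀ s, Measurable (σ s) := by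
    intro s
    -- This is the image of `T` under `line e k`, written measurably by means of the left inverse
    -- `(parent e)^[top k]`.
    let R : ℤ → Set X := fun k => {x | (parent e)^[top k] x ∈ T ∧
      ρ (line e k ((parent e)^[top k] x)) = ρ x}
    have hR : ∀ k x, x ∈ R k ↔ ∃ t ∈ T, line e k t = x := fun k x => by
      constructor
      · rintro ⟨h1, h2⟩
        exact ⟨_, h1, hρi h2⟩
      · rintro ⟨t, ht, rfl⟩
        simp only [R, mem_ofPred_eq, htop, and_true]
        exact ht
    have hRm : ∀ k, MeasurableSet (R k) := fun k =>
      (((measurable_parent e).iterate _) hTm).inter (measurableSet_eq_fun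
        (hρ.comp ((measurable_line e hρ hρi k).comp ((measurable_parent e).iterate _))) hρ)
    intro C hC
    have : σ s ⁻¹' C =
        (⋃ k, R k ∩ (fun x => line e (k + s) ((parent e)^[top k] x)) ⁻¹' C) ∪
          (C \ ⋃ k, R k) := by
      ext x
      simp only [mem_preimage, mem_union, mem_iUnion, mem_inter_iff, mem_sdiff, hR]
      rcases hdich x with ⟨k, t, ht, rfl⟩ | h
      · rw [hσ _ _ _ ht]
        constructor
        · intro h
          exact Or.inl ⟨k, ⟨t, ht, rfl⟩, by rwa [htop]⟩
        · rintro (⟨k', ⟨t', ht', h1⟩, h2⟩ | ⟨-, h⟩)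
          · obtain ⟨rfl, rfl⟩ := line_inj e (hTQ _ ht') (hTQ _ ht) h1
            rwa [htop] at h2
          · exact absurd ⟨k, t, ht, rfl⟩ h
      · rw [hσ' s x h]
        constructor
        · exact fun hx => Or.inr ⟨hx, fun ⟨k, t, ht, h1⟩ => h k t ht h1⟩
        · rintro (⟨k, ⟨t, ht, h1⟩, -⟩ | ⟨hx, -⟩)
          · exact absurd h1 (h k t ht)
          · exact hx
    rw [this]
    refine (MeasurableSet.iUnion fun k => (hRm k).inter ?_).union (hC.diff (.iUnion hRm))
    exact ((measurable_line e hρ hρi _).comp ((measurable_parent e).iterate _)) hC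
  let σe : X ≃ᵐ X := ⟨⟨σ (-2), σ 2, fun x => by simpa using hσσ (-2) x, hσσ 2⟩, hσm (-2), hσm 2⟩
  -- Shifting every line by two before taking parents keeps the map two-to-one. The cut point `t`
  -- now goes to the first point of its ray, each ray is pushed outwards forever, and the siblings
  -- fill the vacated places: those of index 1, 2 and `k + 3` go to `t`, `parent e t` and `ray e (k
  -- + 1) t`.
  let ψ : X → X := fun x => parent e (σ (-2) x)
  have hψ0 : ∀ x, (∀ k, ∀ t ∈ T, line e k t ≠ x) → ψ x = parent e x := fun x hx => by
    simp only [ψ, hσ' _ x hx]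
  have hψray : ∀ k t, t ∈ T → ψ (ray e k t) = ray e (k + 1) t := fun k t ht => by
    simp only [ψ]
    rw [← line_neg, hσ _ _ _ ht, show -(k : ℤ) + -2 = -((k + 2 : ℕ) : ℤ) by push_cast; ring,
      line_neg, parent_ray_succ]
  have hψ1 : ∀ t ∈ T, ψ (line e 1 t) = t := fun t ht => by
    simp only [ψ]
    rw [hσ _ _ _ ht, show (1 : ℤ) + -2 = -((1 : ℕ) : ℤ) by norm_num, line_neg, parent_ray_succ]
    rfl
  have hψ2 : ∀ t ∈ T, ψ (line e 2 t) = parent e t := fun t ht => by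
    simp only [ψ]
    rw [hσ _ _ _ ht]; rfl
  have hψ3 : ∀ (k : ℕ), ∀ t ∈ T, ψ (line e (k + 3) t) = ray e (k + 1) t := fun k t ht => by
    simp only [ψ]
    rw [hσ _ _ _ ht, show (k : ℤ) + 3 + -2 = k + 1 by ring, line_succ, parent_child]
  have hit : ∀ n k t, t ∈ T → ψ^[n] (ray e k t) = ray e (k + n) t := fun n k t ht => by
    induction n with
    | zero => rfl
    | succ n ih => rw [iterate_succ_apply', ih, hψray _ _ ht]; rfl
  have hreachψ : ∀ x ∈ Q, ∃ k, ψ^[k] x ∈ T := by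
    intro x hx
    obtain ⟨k, hk⟩ := hreach x hx
    induction k generalizing x with
    | zero => exact ⟨0, hk⟩
    | succ k ih =>
      by_cases hxT : x ∈ T
      · exact ⟨0, hxT⟩
      have hfix : ψ x = parent e x := hψ0 x fun j t ht h => by
        rcases int_cases j with ⟨n, rfl⟩ | ⟨n, rfl⟩
        · exact line_succ_notMem e n t (h ▸ hx)
        · rw [line_neg] at h
          cases n with
          | zero => exact hxT (h ▸ ht)
          | succ n => exact ray_succ_notMem e n t (h ▸ hx)
      obtain ⟨j, hj⟩ := ih (parent e x) (parent_mem_periodicPts e hx) (by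
        rwa [iterate_succ_apply] at hk)
      exact ⟨j + 1, by rw [iterate_succ_apply, hfix]; exact hj⟩
  have hmain : ∀ x, x ∉ periodicPts ψ := by
    intro x hx
    -- A periodic point of `ψ` lies neither on a ray, which never returns, nor in `Q`, which flows
    -- into rays. Hence `ψ` agrees with `parent e` along its orbit, which puts it in `Q` after all.
    have hray : ∀ x ∈ periodicPts ψ, ∀ k, ∀ t ∈ T, x ≠ ray e k t := by
      rintro _ ⟨n, hn, hx⟩ k t ht rfl
      have h1 : ψ^[n] (ray e k t) = ray e k t := hx
      rw [hit _ _ _ ht] at h1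
      have := (ray_inj e (hTQ _ ht) (hTQ _ ht) h1).1
      omega
    have hstep : ∀ x ∈ periodicPts ψ, ∀ n, ψ^[n] x ∈ periodicPts ψ := by
      rintro x ⟨m, hm, hx⟩ n
      exact ⟨m, hm, hx.apply_iterate n⟩
    have hnQ : ∀ x ∈ periodicPts ψ, x ∉ Q := fun x hx hxQ => by
      obtain ⟨k, hk⟩ := hreachψ x hxQ
      exact hray _ (hstep x hx k) 0 _ hk rfl
    have hoff : ∀ x ∈ periodicPts ψ, ψ x = parent e x := fun x hx => hψ0 x fun j t ht h => by
      subst h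
      have hx1 := hstep _ hx 1
      rw [iterate_one] at hx1
      rcases int_cases j with ⟨n, rfl⟩ | ⟨n, rfl⟩
      · obtain rfl | rfl | ⟨n, rfl⟩ : n = 0 ∨ n = 1 ∨ ∃ m, n = m + 2 := by
          rcases n with _ | _ | m
          exacts [Or.inl rfl, Or.inr (Or.inl rfl), Or.inr (Or.inr ⟨m, rfl⟩)]
        · exact hray _ hx1 0 t ht (hψ1 t ht)
        · have h2 : ψ (line e (((1 : ℕ) : ℤ) + 1) t) = parent e t := hψ2 t ht
          rw [h2] at hx1
          exact hnQ _ hx1 (parent_mem_periodicPts e (hTQ _ ht))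
        · rw [show ((n + 2 : ℕ) : ℤ) + 1 = n + 3 by push_cast; ring, hψ3 n t ht] at hx1
          exact hray _ hx1 _ t ht rfl
      · exact hray _ hx n t ht (line_neg e n t)
    have hall : ∀ n, ψ^[n] x = (parent e)^[n] x := fun n => by
      induction n with
      | zero => rfl
      | succ n ih =>
        exact (iterate_succ_apply' ψ n x).trans ((hoff _ (hstep x hx n)).trans
          ((congrArg (parent e) ih).trans (iterate_succ_apply' (parent e) n x).symm))
    obtain ⟨n, hn, hxn⟩ := id hx
    exact hnQ x hx ⟨n, hn, by rw [IsPeriodicPt, IsFixedPt, ← hall]; exact hxn⟩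
  refine ⟨σe.trans e, hmain, ?_⟩
  -- The shift by two joins points of a line having a common ancestor at most three levels up; three
  -- is needed for siblings of index at least two.
  refine hmov.comp (hmov.of_iterate_eq (g := σ (-2)) 3 fun x => ?_)
  rcases hdich x with ⟨j, t, ht, rfl⟩ | h
  · rw [hσ _ _ _ ht]
    rcases int_cases j with ⟨n, rfl⟩ | ⟨n, rfl⟩
    · match n with
      | 0 =>
        refine ⟨0, by simp, 1, by simp, ?_⟩
        change line e (-(1 : ℕ)) t = parent e (line e ((0 : ℕ) + 1) t)
        rw [line_neg, line_succ, parent_child]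
      | 1 =>
        refine ⟨0, by simp, 3, by simp, ?_⟩
        change t = parent e (parent e (parent e (line e ((1 : ℕ) + 1) t)))
        rw [line_succ, parent_child, parent_ray_succ, parent_ray_succ]
        rfl
      | n + 2 =>
        refine ⟨1, by simp, 3, by simp, ?_⟩
        rw [show ((n + 2 : ℕ) : ℤ) + 1 + -2 = n + 1 by push_cast; ring]
        change parent e (line e (n + 1) t) =
          parent e (parent e (parent e (line e ((n + 2 : ℕ) + 1) t)))
        rw [line_succ, line_succ, parent_child, parent_child, parent_ray_succ, parent_ray_succ]
    · refine ⟨2, by simp, 0, by simp, ?_⟩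
      rw [show -(n : ℤ) + -2 = -((n + 2 : ℕ) : ℤ) by push_cast; ring, line_neg, line_neg]
      rw [add_comm n 2]; exact iterate_parent_ray e 2 n t
  · exact ⟨0, by simp, 0, by simp, by rw [hσ' _ x h]⟩

end Surgery

end Cycles

/-! ### Hall's condition under removal of sparse pairs -/

section Hall

open Set Function Pointwise

/-- A bipartite graph whose edges move points by elements of a finite symmetric set `W`. -/
structure IsLocalGraph {Λ Z : Type*} [Group Λ] [MulAction Λ Z] (W : Finset Λ) (Adj : Z → Z → Prop)
    (side : Z → Bool) : Prop where
  one_mem : 1 ∈ W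
  inv_mem : ∀ γ ∈ W, γ⁻¹ ∈ W
  symm : ∀ z w, Adj z w → Adj w z
  exists_mem : ∀ z w, Adj z w → ∃ γ ∈ W, w = γ • z
  side_ne : ∀ z w, Adj z w → side z ≠ side w

open scoped Classical in
/-- The neighbours of `F` in `U`, for a graph whose edges move points by elements of `W`. -/
noncomputable def nbhd {Λ Z : Type*} [Group Λ] [MulAction Λ Z] (W : Finset Λ) (Adj : Z → Z → Prop)
    (U : Set Z) (F : Finset Z) : Finset Z :=
  (W • F).filter fun w => w ∈ U ∧ ∃ z ∈ F, Adj z w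

section Graph

open scoped Classical

variable {Λ Z : Type*} [Group Λ] [MulAction Λ Z] (W : Finset Λ) (Adj : Z → Z → Prop)

/-- Hall's condition in the induced subgraph on `U`. -/
def HallOn (U : Set Z) : Prop :=
  ∀ F : Finset Z, (F : Set Z) ⊆ U → F.card ≤ (nbhd W Adj U F).card

/-- Hall's condition in the induced subgraph on `U`, for subsets of the orbit of `z`. -/
def HallOnOrbit (U : Set Z) (z : Z) : Prop :=
  ∀ K : Finset Λ, ((K.image (· • z) : Finset Z) : Set Z) ⊆ U →
    (K.image (· • z)).card ≤ (nbhd W Adj U (K.image (· • z))).card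

/-- A set that is not the union of two nonempty sets without common neighbours. -/
def IsClustered (F : Finset Z) : Prop :=
  ∀ F₁ ⊆ F, F₁.Nonempty → (F \ F₁).Nonempty → ∃ a ∈ F₁, ∃ b ∈ F \ F₁, ∃ c, Adj a c ∧ Adj b c

/-- Large clustered subsets of `U` are expanded by the factor `1 + 2 ^ (-n)`. -/
def ExpandsOn (n : ℕ) (U : Set Z) : Prop :=
  ∀ F : Finset Z, (F : Set Z) ⊆ U → IsClustered Adj F → 2 ^ (n + 1) ≤ F.card →
    (2 ^ n + 1) * F.card ≤ 2 ^ n * (nbhd W Adj U F).card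

/-- What is left of `U` when the points of `A` are removed together with their partners. -/
def remaining (A U : Set Z) (g : Z → Λ) : Set Z :=
  {w | w ∈ U ∧ ∀ z ∈ A ∩ U, w ≠ z ∧ w ≠ g z • z}

variable {W Adj} {side : Z → Bool}

theorem HallOn.hallOnOrbit {U : Set Z} (h : HallOn W Adj U) (z : Z) : HallOnOrbit W Adj U z :=
  fun _ hK => h _ hK

theorem mem_nbhd (hG : IsLocalGraph W Adj side) {U : Set Z} {F : Finset Z} {w : Z} :
    w ∈ nbhd W Adj U F ↔ w ∈ U ∧ ∃ z ∈ F, Adj z w := by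
  simp only [nbhd, Finset.mem_filter, and_iff_right_iff_imp]
  rintro ⟨-, z, hz, hzw⟩
  obtain ⟨γ, hγ, rfl⟩ := hG.exists_mem z w hzw
  exact Finset.smul_mem_smul hγ hz

/-- A locally finite bipartite graph that satisfies Hall's condition has a perfect matching. -/
theorem HallOn.exists_matching (hG : IsLocalGraph W Adj side) {U : Set Z}
    (hU : HallOn W Adj U) :
    ∃ M : Z → Z, ∀ z ∈ U, M z ∈ U ∧ Adj z (M z) ∧ M (M z) = z := by
  obtain ⟨f, hfi, hf⟩ := (Finset.all_card_le_biUnion_card_iff_exists_injective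
    (fun z : U => nbhd W Adj U {z.1})).1 fun s => by
      have h := hU (s.map (Embedding.subtype _)) (by
        intro z hz
        obtain ⟨y, -, rfl⟩ := Finset.mem_map.1 hz
        exact y.2)
      rw [Finset.card_map] at h
      refine h.trans (Finset.card_le_card fun w hw => ?_)
      obtain ⟨hwU, z, hz, hzw⟩ := (mem_nbhd hG).1 hw
      obtain ⟨y, hy, rfl⟩ := Finset.mem_map.1 hz
      exact Finset.mem_biUnion.2 ⟨y, hy, (mem_nbhd hG).2 ⟨hwU, _, by simp, hzw⟩⟩
  have hf' : ∀ z : U, f z ∈ U ∧ Adj z.1 (f z) := fun z => by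
    simpa using (mem_nbhd hG).1 (hf z)
  let p : U → U := fun z => ⟨f z, (hf' z).1⟩
  have hp : Injective p := fun x y h => hfi (congrArg Subtype.val h)
  have hside : ∀ z : U, side (p z).1 = !side z.1 := fun z => by
    have := hG.side_ne _ _ (hf' z).2
    revert this
    change side z.1 ≠ side (f z) → side (f z) = !side z.1
    cases side z.1 <;> cases side (f z) <;> simp
  -- Hall's injection along edges swaps the sides. Its two restrictions are combined by
  -- Schröder–Bernstein into a bijection that still follows edges.
  let fL : {z : U // side z.1 = true} → {z : U // side z.1 = false} := fun z =>
    ⟨p z.1, by rw [hside, z.2]; rfl⟩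
  let fR : {z : U // side z.1 = false} → {z : U // side z.1 = true} := fun z =>
    ⟨p z.1, by rw [hside, z.2]; rfl⟩
  have hL : Injective fL := fun x y h => Subtype.ext (hp (congrArg Subtype.val h))
  have hR : Injective fR := fun x y h => Subtype.ext (hp (congrArg Subtype.val h))
  obtain ⟨m, hm, hmAdj⟩ := Embedding.schroeder_bernstein_of_rel hL hR
    (fun x y => Adj x.1.1 y.1.1) (fun x => (hf' x.1).2) (fun y => hG.symm _ _ (hf' y.1).2)
  let E := Equiv.ofBijective m hm
  let M : Z → Z := fun z => if h : z ∈ U then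
    if hs : side z = true then (E ⟨⟨z, h⟩, hs⟩).1.1
    else (E.symm ⟨⟨z, h⟩, by simpa using hs⟩).1.1 else z
  have hM1 : ∀ z : {z : U // side z.1 = true}, M z.1.1 = (E z).1.1 := fun z => by
    simp only [M, z.1.2, z.2, dif_pos]
  have hM2 : ∀ z : {z : U // side z.1 = false}, M z.1.1 = (E.symm z).1.1 := fun z => by
    simp only [M, z.1.2, z.2, dif_pos]
    simp
  refine ⟨M, fun z hz => ?_⟩
  cases hs : side z
  · have h1 := hM2 ⟨⟨z, hz⟩, hs⟩
    simp only at h1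
    refine ⟨h1 ▸ (E.symm _).1.2, ?_, ?_⟩
    · rw [h1]
      have := hmAdj (E.symm ⟨⟨z, hz⟩, hs⟩)
      rw [show m (E.symm ⟨⟨z, hz⟩, hs⟩) = _ from E.apply_symm_apply _] at this
      exact hG.symm _ _ this
    · rw [h1, hM1, E.apply_symm_apply]
  · have h1 := hM1 ⟨⟨z, hz⟩, hs⟩
    simp only at h1
    refine ⟨h1 ▸ (E _).1.2, ?_, ?_⟩
    · rw [h1]
      exact hmAdj ⟨⟨z, hz⟩, hs⟩
    · rw [h1, hM2, E.symm_apply_apply]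

/-- Every vertex has a partner whose removal preserves Hall's condition. -/
theorem HallOn.exists_partner (hG : IsLocalGraph W Adj side) {U : Set Z}
    (hU : HallOn W Adj U) {z : Z} (hz : z ∈ U) :
    ∃ γ : Λ, γ ∈ W ∧ γ • z ∈ U ∧ Adj z (γ • z) ∧ HallOn W Adj (U \ {z, γ • z}) := by
  obtain ⟨M, hM⟩ := hU.exists_matching hG
  obtain ⟨hMz, hadj, hMM⟩ := hM z hz
  obtain ⟨γ, hγ, hγz⟩ := hG.exists_mem z _ hadj
  refine ⟨γ, hγ, hγz ▸ hMz, hγz ▸ hadj, fun F hF => ?_⟩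
  rw [← hγz] at hF ⊢
  -- After removal of a matched pair, the perfect matching `M` still matches the rest and so
  -- witnesses Hall's condition.
  have hinj : Set.InjOn M F := fun x hx y hy h => by
    rw [← (hM x (hF hx).1).2.2, h, (hM y (hF hy).1).2.2]
  rw [← Finset.card_image_of_injOn hinj]
  refine Finset.card_le_card fun w hw => ?_
  obtain ⟨x, hx, rfl⟩ := Finset.mem_image.1 hw
  obtain ⟨hxU, hxn⟩ := hF hx
  obtain ⟨h1, h2, h3⟩ := hM x hxU
  refine (mem_nbhd hG).2 ⟨⟨h1, ?_⟩, x, hx, h2⟩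
  rintro (h | h)
  · exact hxn (Or.inr (by rw [← h]; exact h3.symm))
  · exact hxn (Or.inl (by rw [← h3, h, hMM]))

/-- A set that splits into parts without common neighbours has the disjoint union of their
neighbourhoods, so the inequality adds up by induction. -/
theorem HallOn.of_isClustered (hG : IsLocalGraph W Adj side) {U : Set Z}
    (h : ∀ F : Finset Z, (F : Set Z) ⊆ U → IsClustered Adj F → F.card ≤ (nbhd W Adj U F).card) :
    HallOn W Adj U := by
  intro F
  induction F using Finset.strongInduction with
  | H F ih =>
    intro hF
    by_cases hc : IsClustered Adj F
    · exact h F hF hc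
    unfold IsClustered at hc
    push Not at hc
    obtain ⟨F₁, hsub, hne, hne', hdis⟩ := hc
    have h1 := ih F₁ (hsub.ssubset_of_ne fun h => by simp [h] at hne')
      ((Finset.coe_subset.2 hsub).trans hF)
    have h2 := ih (F \ F₁) (Finset.sdiff_ssubset hsub hne)
      ((Finset.coe_subset.2 Finset.sdiff_subset).trans hF)
    rw [← Finset.card_sdiff_add_card_eq_card hsub]
    have hd : Disjoint (nbhd W Adj U (F \ F₁)) (nbhd W Adj U F₁) := by
      rw [Finset.disjoint_left]
      intro c hc hc'
      obtain ⟨-, b, hb, hbc⟩ := (mem_nbhd hG).1 hc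
      obtain ⟨-, a, ha, hac⟩ := (mem_nbhd hG).1 hc'
      exact hdis a ha b hb c hac hbc
    refine (add_le_add h2 h1).trans ?_
    rw [← Finset.card_union_of_disjoint hd]
    refine Finset.card_le_card (Finset.union_subset ?_ ?_)
    · intro c hc
      obtain ⟨hcU, b, hb, hbc⟩ := (mem_nbhd hG).1 hc
      exact (mem_nbhd hG).2 ⟨hcU, b, Finset.sdiff_subset hb, hbc⟩
    · intro c hc
      obtain ⟨hcU, b, hb, hbc⟩ := (mem_nbhd hG).1 hc
      exact (mem_nbhd hG).2 ⟨hcU, b, hsub hb, hbc⟩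

/-- The part of `F` within distance `r` of `z`. -/
noncomputable def ballIn (W : Finset Λ) (F : Finset Z) (r : ℕ) (z : Z) : Finset Z :=
  F.filter fun v => ∃ γ ∈ W ^ r, v = γ • z

/-- Members of a clustered set are linked by steps of length two, so enlarging the radius by two
gains a point until `F` is exhausted. -/
theorem card_ballIn (hG : IsLocalGraph W Adj side) {F : Finset Z} (hF : IsClustered Adj F) {z : Z}
    (hne : (ballIn W F 2 z).Nonempty) (j : ℕ) :
    F ⊆ ballIn W F (2 * j + 2) z ∨ j + 1 ≤ (ballIn W F (2 * j + 2) z).card := by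
  induction j with
  | zero => exact Or.inr hne.card_pos
  | succ j ih =>
    have hmono : ballIn W F (2 * j + 2) z ⊆ ballIn W F (2 * (j + 1) + 2) z := fun v hv => by
      obtain ⟨hvF, γ, hγ, rfl⟩ := Finset.mem_filter.1 hv
      exact Finset.mem_filter.2 ⟨hvF, γ,
        Finset.pow_subset_pow_right hG.one_mem (by omega) hγ, rfl⟩
    rcases ih with h | h
    · exact Or.inl (h.trans hmono)
    by_cases hsub : F ⊆ ballIn W F (2 * j + 2) z
    · exact Or.inl (hsub.trans hmono)
    right
    obtain ⟨a, ha, b, hb, c, hac, hbc⟩ := hF (ballIn W F (2 * j + 2) z) (Finset.filter_subset _ _)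
      (Finset.card_pos.1 (by omega)) (Finset.sdiff_nonempty.2 hsub)
    obtain ⟨haF, γ, hγ, rfl⟩ := Finset.mem_filter.1 ha
    obtain ⟨κ, hκ, rfl⟩ := hG.exists_mem _ _ hac
    obtain ⟨η, hη, rfl⟩ := hG.exists_mem _ _ (hG.symm _ _ hbc)
    obtain ⟨hbF, hb'⟩ := Finset.mem_sdiff.1 hb
    have : insert (η • κ • γ • z) (ballIn W F (2 * j + 2) z) ⊆
        ballIn W F (2 * (j + 1) + 2) z := by
      refine Finset.insert_subset (Finset.mem_filter.2 ⟨hbF, η * (κ * γ), ?_, ?_⟩) hmono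
      · rw [show 2 * (j + 1) + 2 = (2 * j + 2) + 1 + 1 by ring, pow_succ', pow_succ']
        exact Finset.mul_mem_mul hη (Finset.mul_mem_mul hκ hγ)
      · rw [mul_smul, mul_smul]
    have := Finset.card_le_card this
    rw [Finset.card_insert_of_notMem hb'] at this
    omega

theorem IsLocalGraph.inv_mem_pow (hG : IsLocalGraph W Adj side) {γ : Λ} {r : ℕ}
    (h : γ ∈ W ^ r) : γ⁻¹ ∈ W ^ r := by
  have hW : W⁻¹ = W := by
    ext x
    rw [Finset.mem_inv']
    exact ⟨fun h => by simpa using hG.inv_mem _ h, hG.inv_mem x⟩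
  rw [← hW, inv_pow]
  exact Finset.inv_mem_inv h

/-- A clustered set near several points of a discrete set is large. -/
theorem mul_card_le_of_discrete (hG : IsLocalGraph W Adj side) {F : Finset Z}
    (hF : IsClustered Adj F) {M : ℕ} (hM : 1 ≤ M) {t : Finset Z}
    (hd : ∀ z ∈ t, ∀ γ ∈ W ^ (4 * M), γ • z ∈ t → γ • z = z)
    (hne : ∀ z ∈ t, (ballIn W F 2 z).Nonempty) (ht : 2 ≤ t.card) :
    t.card * M ≤ F.card := by
  obtain ⟨j, rfl⟩ : ∃ j, M = j + 1 := ⟨M - 1, by omega⟩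
  have hdis : ∀ z ∈ t, ∀ z' ∈ t, z ≠ z' →
      Disjoint (ballIn W F (2 * j + 2) z) (ballIn W F (2 * j + 2) z') := by
    intro z hz z' hz' hzz
    rw [Finset.disjoint_left]
    intro v hv hv'
    obtain ⟨-, γ, hγ, rfl⟩ := Finset.mem_filter.1 hv
    obtain ⟨-, κ, hκ, h⟩ := Finset.mem_filter.1 hv'
    have h' : (κ⁻¹ * γ) • z = z' := by rw [mul_smul, h, inv_smul_smul]
    refine hzz ?_
    rw [← h']
    refine (hd z hz _ ?_ (h' ▸ hz')).symm
    rw [show 4 * (j + 1) = (2 * j + 2) + (2 * j + 2) by ring, pow_add]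
    exact Finset.mul_mem_mul (hG.inv_mem_pow hκ) hγ
  -- No ball contains all of `F`, as another point of `t` has a disjoint ball that meets `F`.
  have hball : ∀ z ∈ t, j + 1 ≤ (ballIn W F (2 * j + 2) z).card := by
    intro z hz
    refine (card_ballIn hG hF (hne z hz) j).resolve_left fun hsub => ?_
    obtain ⟨z', hz', hzz⟩ := Finset.exists_mem_ne (by omega : 1 < t.card) z
    obtain ⟨v, hv⟩ := hne z' hz'
    obtain ⟨hvF, γ, hγ, rfl⟩ := Finset.mem_filter.1 hv
    exact Finset.disjoint_left.1 (hdis z hz z' hz' hzz.symm) (hsub hvF) (Finset.mem_filter.2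
      ⟨hvF, γ, Finset.pow_subset_pow_right hG.one_mem (by omega) hγ, rfl⟩)
  calc t.card * (j + 1) = ∑ z ∈ t, (j + 1) := by simp
    _ ≤ ∑ z ∈ t, (ballIn W F (2 * j + 2) z).card := Finset.sum_le_sum hball
    _ = (t.biUnion fun z => ballIn W F (2 * j + 2) z).card := (Finset.card_biUnion hdis).symm
    _ ≤ F.card := Finset.card_le_card (Finset.biUnion_subset.2 fun z _ => Finset.filter_subset _ _)

/-- Removing a discrete set of vertices with suitable partners preserves Hall's condition and
weakens the expansion slightly. -/
theorem hallOn_remaining (hG : IsLocalGraph W Adj side) {A U : Set Z} {n : ℕ} {g : Z → Λ}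
    (hd : ∀ z ∈ A, ∀ γ ∈ W ^ (2 ^ (n + 4)), γ • z ∈ A → γ • z = z)
    (hU : HallOn W Adj U) (hE : ExpandsOn W Adj n U)
    (hg : ∀ z ∈ A ∩ U, g z ∈ W ∧ HallOnOrbit W Adj (U \ {z, g z • z}) z) :
    HallOn W Adj (remaining A U g) ∧ ExpandsOn W Adj (n + 1) (remaining A U g) := by
  have key : ∀ F : Finset Z, (F : Set Z) ⊆ remaining A U g → IsClustered Adj F →
      F.card ≤ (nbhd W Adj (remaining A U g) F).card ∧ (2 ^ (n + 2) ≤ F.card →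
        (2 ^ (n + 1) + 1) * F.card ≤ 2 ^ (n + 1) * (nbhd W Adj (remaining A U g) F).card) := by
    intro F hF hFc
    have hFU : (F : Set Z) ⊆ U := fun x hx => (hF hx).1
    set N := nbhd W Adj U F with hN
    set N' := nbhd W Adj (remaining A U g) F with hN'
    -- These are the removed points whose pair takes away a neighbour of `F`; each costs at most two
    -- neighbours.
    let t : Finset Z := (N ∪ W • N).filter fun z => z ∈ A ∩ U ∧ (z ∈ N ∨ g z • z ∈ N)
    have ht : ∀ z, z ∈ t ↔ z ∈ A ∩ U ∧ (z ∈ N ∨ g z • z ∈ N) := by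
      intro z
      simp only [t, Finset.mem_filter, and_iff_right_iff_imp, Finset.mem_union]
      rintro ⟨hz, h | h⟩
      · exact Or.inl h
      · right
        have := Finset.smul_mem_smul (hG.inv_mem _ (hg z hz).1) h
        rwa [inv_smul_smul] at this
    have hcover : N ⊆ N' ∪ (t ∪ t.image fun z => g z • z) := by
      intro c hc
      by_contra hcon
      simp only [Finset.mem_union, not_or, Finset.mem_image, not_exists, not_and] at hcon
      obtain ⟨h1, h2, h3⟩ := hcon
      obtain ⟨hcU, hadj⟩ := (mem_nbhd hG).1 hc
      refine h1 ((mem_nbhd hG).2 ⟨⟨hcU, fun z hz => ⟨?_, ?_⟩⟩, hadj⟩)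
      · rintro rfl
        exact h2 ((ht _).2 ⟨hz, Or.inl hc⟩)
      · rintro rfl
        exact h3 z ((ht _).2 ⟨hz, Or.inr hc⟩) rfl
    have hcard : N.card ≤ N'.card + 2 * t.card := by
      have h1 := (Finset.card_le_card hcover).trans (Finset.card_union_le _ _)
      have h2 := Finset.card_union_le t (t.image fun z => g z • z)
      have h3 : (t.image fun z => g z • z).card ≤ t.card := Finset.card_image_le
      omega
    have hnear : ∀ z ∈ t, (ballIn W F 2 z).Nonempty := by
      intro z hz
      obtain ⟨hzA, h⟩ := (ht z).1 hz
      have hstep : ∀ c ∈ N, ∃ γ ∈ W, γ • c ∈ F := by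
        intro c hc
        obtain ⟨-, v, hv, hvc⟩ := (mem_nbhd hG).1 hc
        obtain ⟨γ, hγ, rfl⟩ := hG.exists_mem _ _ (hG.symm _ _ hvc)
        exact ⟨γ, hγ, hv⟩
      rcases h with h | h
      · obtain ⟨γ, hγ, hv⟩ := hstep _ h
        exact ⟨_, Finset.mem_filter.2 ⟨hv, γ * 1, by
          rw [pow_two]; exact Finset.mul_mem_mul hγ hG.one_mem, by simp⟩⟩
      · obtain ⟨γ, hγ, hv⟩ := hstep _ h
        exact ⟨_, Finset.mem_filter.2 ⟨hv, γ * g z, by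
          rw [pow_two]; exact Finset.mul_mem_mul hγ (hg z hzA).1, by simp [mul_smul]⟩⟩
    have hmany : 2 ≤ t.card → t.card * 2 ^ (n + 2) ≤ F.card := fun h2 => by
      refine mul_card_le_of_discrete hG hFc Nat.one_le_two_pow (fun z hz γ hγ hγz => ?_) hnear h2
      refine hd z ((ht z).1 hz).1.1 γ ?_ ((ht _).1 hγz).1.1
      rwa [show 2 ^ (n + 4) = 4 * 2 ^ (n + 2) by ring]
    -- The loss `2 * t.card` is at most `2 ^ (-(n + 1)) * F.card`, half of the surplus `2 ^ (-n) *
    -- F.card`.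
    have hexp : 2 ^ (n + 1) ≤ F.card → t.card * 2 ^ (n + 2) ≤ F.card →
        (2 ^ (n + 1) + 1) * F.card ≤ 2 ^ (n + 1) * N'.card := by
      intro h1 h2
      have h3 := hE F hFU hFc h1
      have h4 := Nat.mul_le_mul_left (2 ^ n) hcard
      have h5 : t.card * 2 ^ (n + 2) = 4 * (2 ^ n * t.card) := by ring
      rw [h5] at h2
      have e1 : (2 ^ (n + 1) + 1) * F.card = 2 * (2 ^ n * F.card) + F.card := by ring
      have e2 : 2 ^ (n + 1) * N'.card = 2 * (2 ^ n * N'.card) := by ring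
      have e3 : (2 ^ n + 1) * F.card = 2 ^ n * F.card + F.card := by ring
      have e4 : 2 ^ n * (N'.card + 2 * t.card) = 2 ^ n * N'.card + 2 * (2 ^ n * t.card) := by ring
      rw [e3] at h3
      rw [e4] at h4
      rw [e1, e2]
      have h3' : 2 ^ n * F.card + F.card ≤ 2 ^ n * N.card := h3
      omega
    have hpow : 2 ^ (n + 1) ≤ 2 ^ (n + 2) := Nat.pow_le_pow_right (by norm_num) (by omega)
    -- With two or more removals near `F`, Hall's condition follows from the expansion; with none,
    -- from Hall's condition on `U`; with exactly one, from the choice of its partner, since `F`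
    -- then lies in one orbit.
    refine ⟨?_, fun hlarge => ?_⟩
    · rcases le_or_gt 2 t.card with h2 | h2
      · have h3 := hmany h2
        have h4 := hexp (by nlinarith) h3
        have h5 : 2 ^ (n + 1) * F.card ≤ 2 ^ (n + 1) * N'.card := by nlinarith
        exact Nat.le_of_mul_le_mul_left h5 (by positivity)
      · rcases t.eq_empty_or_nonempty with he | ⟨z, hz⟩
        · have := hU F hFU
          rw [he] at hcard
          simp only [Finset.card_empty, mul_zero, add_zero] at hcard
          exact this.trans hcard
        have htz : ∀ z' ∈ t, z' = z := fun z' hz' => Finset.card_le_one.1 (by omega) _ hz' _ hz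
        have horb : ∀ v ∈ F, ∃ γ : Λ, γ • z = v := by
          by_contra! hcon
          obtain ⟨b₀, hb₀, hb₀z⟩ := hcon
          obtain ⟨a₀, ha₀⟩ := hnear z hz
          obtain ⟨ha₀F, γ₀, -, rfl⟩ := Finset.mem_filter.1 ha₀
          obtain ⟨a, ha, b, hb, c, hac, hbc⟩ := hFc (F.filter fun v => ∃ γ : Λ, γ • z = v)
            (Finset.filter_subset _ _) ⟨_, Finset.mem_filter.2 ⟨ha₀F, γ₀, rfl⟩⟩
            ⟨b₀, Finset.mem_sdiff.2 ⟨hb₀, fun h => by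
              obtain ⟨-, γ, hγ⟩ := Finset.mem_filter.1 h
              exact hb₀z γ hγ⟩⟩
          obtain ⟨-, γ, rfl⟩ := Finset.mem_filter.1 ha
          obtain ⟨κ, -, rfl⟩ := hG.exists_mem _ _ hac
          obtain ⟨η, -, rfl⟩ := hG.exists_mem _ _ (hG.symm _ _ hbc)
          obtain ⟨hbF, hbn⟩ := Finset.mem_sdiff.1 hb
          exact hbn (Finset.mem_filter.2 ⟨hbF, η * κ * γ, by simp [mul_smul]⟩)
        choose! k hk using horb
        have himg : (F.image k).image (· • z) = F := by
          rw [Finset.image_image]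
          exact (Finset.image_congr fun v hv => hk v hv).trans Finset.image_id
        have hzA := ((ht z).1 hz).1
        have h3 := (hg z hzA).2 (F.image k)
        rw [himg] at h3
        refine (h3 fun v hv => ⟨(hF hv).1, ?_⟩).trans (Finset.card_le_card fun c hc => ?_)
        · have := (hF hv).2 z hzA
          simp [this.1, this.2]
        · obtain ⟨⟨hcU, hcz⟩, hadj⟩ := (mem_nbhd hG).1 hc
          have hcN : c ∈ N := (mem_nbhd hG).2 ⟨hcU, hadj⟩
          simp only [mem_insert_iff, mem_singleton_iff, not_or] at hcz
          refine (mem_nbhd hG).2 ⟨⟨hcU, fun z' hz' => ⟨?_, ?_⟩⟩, hadj⟩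
          · rintro rfl
            exact hcz.1 (htz _ ((ht _).2 ⟨hz', Or.inl hcN⟩))
          · intro h
            have := htz z' ((ht _).2 ⟨hz', Or.inr (h ▸ hcN)⟩)
            exact hcz.2 (by rw [h, this])
    · refine hexp (hpow.trans hlarge) ?_
      rcases le_or_gt 2 t.card with h2 | h2
      · exact hmany h2
      · exact (Nat.mul_le_mul_right _ (by omega : t.card ≤ 1)).trans (by simpa using hlarge)
  exact ⟨.of_isClustered hG fun F hF hc => (key F hF hc).1, fun F hF hc h => (key F hF hc).2 h⟩

end Graph

end Hall

/-! ### Measurable perfect matchings -/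

section Matching

open Set Function Pointwise

open scoped Classical

section MeasurableMatching

variable {Λ Z : Type*} [Group Λ] [MulAction Λ Z] [MeasurableSpace Z]

/-- Stabilizers may be nontrivial, so points are counted rather than group elements: a new element
adds one exactly when it qualifies and its point is not already counted. -/
theorem measurable_card_image_filter (hm : ∀ γ : Λ, Measurable fun z : Z => γ • z)
    (hdiag : ∀ γ : Λ, MeasurableSet {z : Z | γ • z = z}) (Q : Λ → Z → Prop)
    (hQ : ∀ γ, MeasurableSet {z | Q γ z}) (K : Finset Λ) :
    Measurable fun z : Z => ((K.filter (Q · z)).image (· • z)).card := by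
  induction K using Finset.induction_on with
  | empty => simp
  | insert a K _ ih =>
    have heq : (fun z : Z => (((insert a K).filter (Q · z)).image (· • z)).card) = fun z =>
        ((K.filter (Q · z)).image (· • z)).card +
          if Q a z ∧ ∀ k ∈ K, ¬ (Q k z ∧ k • z = a • z) then 1 else 0 := by
      funext z
      rw [Finset.filter_insert]
      by_cases hq : Q a z
      · rw [if_pos hq, Finset.image_insert]
        by_cases h : ∀ k ∈ K, ¬ (Q k z ∧ k • z = a • z)
        · rw [if_pos ⟨hq, h⟩, Finset.card_insert_of_notMem]
          intro hmem
          obtain ⟨k, hk, hka⟩ := Finset.mem_image.1 hmem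
          obtain ⟨hkK, hkQ⟩ := Finset.mem_filter.1 hk
          exact h k hkK ⟨hkQ, hka⟩
        · rw [if_neg fun h' => h h'.2, Finset.insert_eq_of_mem, add_zero]
          push Not at h
          obtain ⟨k, hk, hkQ, hka⟩ := h
          exact Finset.mem_image.2 ⟨k, Finset.mem_filter.2 ⟨hk, hkQ⟩, hka⟩
      · rw [if_neg hq, if_neg fun h => hq h.1, add_zero]
    rw [heq]
    refine ih.add (Measurable.ite ?_ measurable_const measurable_const)
    have hset : {z | Q a z ∧ ∀ k ∈ K, ¬ (Q k z ∧ k • z = a • z)} =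
        {z | Q a z} ∩ ⋂ k ∈ K, ({z | Q k z} ∩
          (fun z => a • z) ⁻¹' {z : Z | (k * a⁻¹) • z = z})ᶜ := by
      ext z
      simp [mul_smul]
    rw [hset]
    exact (hQ a).inter (Finset.measurableSet_biInter _ fun k _ =>
      ((hQ k).inter (hm a (hdiag _))).compl)

variable {W : Finset Λ} {Adj : Z → Z → Prop} {side : Z → Bool}

/-- Within one orbit, finite sets are given by the countably many finite `K ⊆ Λ`; this is why Hall's
condition was restricted to orbits. -/
theorem measurableSet_hallOnOrbit [Countable Λ] (hG : IsLocalGraph W Adj side)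
    (hm : ∀ γ : Λ, Measurable fun z : Z => γ • z)
    (hdiag : ∀ γ : Λ, MeasurableSet {z : Z | γ • z = z})
    (hAdj : ∀ γ : Λ, MeasurableSet {z | Adj z (γ • z)}) (V : Z → Set Z)
    (hV : ∀ γ : Λ, MeasurableSet {z | γ • z ∈ V z}) :
    MeasurableSet {z | HallOnOrbit W Adj (V z) z} := by
  have hset : {z | HallOnOrbit W Adj (V z) z} = ⋂ K : Finset Λ,
      (⋂ γ ∈ K, {z | γ • z ∈ V z})ᶜ ∪
        {z | (K.image (· • z)).card ≤
          (((W * K).filter fun κ => κ • z ∈ V z ∧ ∃ γ ∈ K, Adj (γ • z) (κ • z)).image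
            (· • z)).card} := by
    ext z
    simp only [HallOnOrbit, mem_ofPred_eq, mem_iInter, mem_union, mem_compl_iff]
    refine forall_congr' fun K => ?_
    have h1 : ((K.image (· • z) : Finset Z) : Set Z) ⊆ V z ↔ ∀ γ ∈ K, γ • z ∈ V z := by
      simp [subset_def]
    have h2 : nbhd W Adj (V z) (K.image (· • z)) =
        ((W * K).filter fun κ => κ • z ∈ V z ∧ ∃ γ ∈ K, Adj (γ • z) (κ • z)).image (· • z) := by
      ext w
      rw [mem_nbhd hG]
      simp only [Finset.mem_image, Finset.mem_filter]
      constructor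
      · rintro ⟨hw, _, ⟨γ, hγ, rfl⟩, hadj⟩
        obtain ⟨κ, hκ, rfl⟩ := hG.exists_mem _ _ hadj
        rw [← mul_smul] at hw hadj ⊢
        exact ⟨κ * γ, ⟨Finset.mul_mem_mul hκ hγ, hw, γ, hγ, hadj⟩, rfl⟩
      · rintro ⟨κ, ⟨-, hw, γ, hγ, hadj⟩, rfl⟩
        exact ⟨hw, _, ⟨γ, hγ, rfl⟩, hadj⟩
    rw [h1, h2]
    exact imp_iff_not_or
  rw [hset]
  refine .iInter fun K => (Finset.measurableSet_biInter _ fun γ _ => hV γ).compl.union ?_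
  suffices hQ : ∀ κ : Λ, MeasurableSet {z | κ • z ∈ V z ∧ ∃ γ ∈ K, Adj (γ • z) (κ • z)} by
    have h1 : Measurable fun z : Z => (K.image (· • z)).card := by
      have h := measurable_card_image_filter hm hdiag (fun _ _ => True) (fun _ => .const True) K
      simpa only [Finset.filter_true] using h
    have h2 := measurable_card_image_filter hm hdiag
      (fun κ z => κ • z ∈ V z ∧ ∃ γ ∈ K, Adj (γ • z) (κ • z)) hQ (W * K)
    refine measurableSet_le h1 ?_
    convert h2
  intro κ
  have : {z | κ • z ∈ V z ∧ ∃ γ ∈ K, Adj (γ • z) (κ • z)} = {z | κ • z ∈ V z} ∩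
      ⋃ γ ∈ K, (fun z => γ • z) ⁻¹' {z | Adj z ((κ * γ⁻¹) • z)} := by
    ext z
    simp [mul_smul]
  rw [this]
  exact (hV κ).inter (Finset.measurableSet_biUnion _ fun γ _ => hm γ (hAdj _))

theorem measurableSet_smul_eq_smul (hm : ∀ γ : Λ, Measurable fun z : Z => γ • z)
    (hdiag : ∀ γ : Λ, MeasurableSet {z : Z | γ • z = z}) (γ κ : Λ) :
    MeasurableSet {z : Z | γ • z = κ • z} := by
  have : {z : Z | γ • z = κ • z} = (fun z => κ • z) ⁻¹' {z | (γ * κ⁻¹) • z = z} := by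
    ext z; simp [mul_smul]
  rw [this]
  exact hm κ (hdiag _)

theorem measurableSet_smul_eq_choice [Countable Λ] (hm : ∀ γ : Λ, Measurable fun z : Z => γ • z)
    (hdiag : ∀ γ : Λ, MeasurableSet {z : Z | γ • z = z}) {g : Z → Λ}
    (hg : ∀ γ, MeasurableSet {z | g z = γ}) (γ : Λ) :
    MeasurableSet {z : Z | γ • z = g z • z} := by
  have : {z : Z | γ • z = g z • z} = ⋃ κ, {z | g z = κ} ∩ {z | γ • z = κ • z} := by
    ext z; simp
  rw [this]
  exact .iUnion fun κ => (hg κ).inter (measurableSet_smul_eq_smul hm hdiag γ κ)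

/-- A measurable choice of partners that preserves Hall's condition. -/
theorem exists_measurable_partner [Countable Λ] (hG : IsLocalGraph W Adj side)
    (hm : ∀ γ : Λ, Measurable fun z : Z => γ • z)
    (hdiag : ∀ γ : Λ, MeasurableSet {z : Z | γ • z = z})
    (hAdj : ∀ γ : Λ, MeasurableSet {z | Adj z (γ • z)}) {U : Set Z} (hUm : MeasurableSet U)
    (hU : HallOn W Adj U) :
    ∃ g : Z → Λ, (∀ γ, MeasurableSet {z | g z = γ}) ∧
      ∀ z ∈ U, g z ∈ W ∧ g z • z ∈ U ∧ Adj z (g z • z) ∧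
        HallOnOrbit W Adj (U \ {z, g z • z}) z := by
  let D : Λ → Set Z := fun γ => {z | γ ∈ W ∧ γ • z ∈ U ∧ Adj z (γ • z) ∧
    HallOnOrbit W Adj (U \ {z, γ • z}) z}
  have hD : ∀ γ, MeasurableSet (D γ) := fun γ => by
    refine (MeasurableSet.const (γ ∈ W)).inter ((hm γ hUm).inter ((hAdj γ).inter
      (measurableSet_hallOnOrbit hG hm hdiag hAdj (fun z => U \ {z, γ • z}) fun κ => ?_)))
    have : {z : Z | κ • z ∈ U \ {z, γ • z}} = (fun z => κ • z) ⁻¹' U \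
        ({z | κ • z = z} ∪ {z | κ • z = γ • z}) := by
      ext z; simp
    rw [this]
    exact (hm κ hUm).diff ((hdiag κ).union (measurableSet_smul_eq_smul hm hdiag κ γ))
  obtain ⟨g, hg, hgD⟩ := exists_measurable_choice D hD
  refine ⟨g, hg, fun z hz => hgD z ?_⟩
  obtain ⟨γ, h1, h2, h3, h4⟩ := hU.exists_partner hG hz
  exact ⟨γ, h1, h2, h3, h4.hallOnOrbit z⟩

theorem measurableSet_remaining [Countable Λ] (hm : ∀ γ : Λ, Measurable fun z : Z => γ • z) {A U : Set Z} (hA : MeasurableSet A)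
    (hU : MeasurableSet U) {g : Z → Λ} (hg : ∀ γ, MeasurableSet {z | g z = γ}) :
    MeasurableSet (remaining A U g) := by
  have : remaining A U g = (U \ (A ∩ U)) \
      ⋃ γ : Λ, (fun z => γ⁻¹ • z) ⁻¹' (A ∩ U ∩ {z | g z = γ}) := by
    ext w
    simp only [remaining, mem_ofPred_eq, mem_sdiff, mem_iUnion, mem_preimage, not_exists]
    constructor
    · rintro ⟨hw, h⟩
      refine ⟨⟨hw, fun hA => (h w hA).1 rfl⟩, fun γ hγ => ?_⟩
      have := (h _ hγ.1).2
      rw [hγ.2, smul_inv_smul] at this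
      exact this rfl
    · rintro ⟨⟨hw, hA⟩, h⟩
      refine ⟨hw, fun z hz => ⟨?_, ?_⟩⟩
      · rintro rfl; exact hA hz
      · rintro rfl
        refine h (g z) ?_
        rw [inv_smul_smul]
        exact ⟨hz, rfl⟩
  rw [this]
  exact (hU.diff (hA.inter hU)).diff
    (.iUnion fun γ => hm γ⁻¹ ((hA.inter hU).inter (hg γ)))

/-- A locally finite bipartite measurable graph in which all finite sets are expanded by the
factor two has a measurable perfect matching, if it is covered by sufficiently discrete measurable
sets. -/
theorem exists_measurable_matching [Countable Λ] (hG : IsLocalGraph W Adj side)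
    (hm : ∀ γ : Λ, Measurable fun z : Z => γ • z)
    (hdiag : ∀ γ : Λ, MeasurableSet {z : Z | γ • z = z})
    (hAdj : ∀ γ : Λ, MeasurableSet {z | Adj z (γ • z)}) (A : ℕ → Set Z)
    (hA : ∀ n, MeasurableSet (A n))
    (hAd : ∀ n, ∀ z ∈ A n, ∀ γ ∈ W ^ (2 ^ (n + 4)), γ • z ∈ A n → γ • z = z)
    (hAc : ∀ z, ∃ n, z ∈ A n)
    (hexp : ∀ F : Finset Z, 2 * F.card ≤ (nbhd W Adj univ F).card) :
    ∃ h : Z → Λ, (∀ γ, MeasurableSet {z | h z = γ}) ∧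
      ∀ z, Adj z (h z • z) ∧ h (h z • z) • h z • z = z := by
  have hstep : ∀ U : Set Z, ∃ g : Z → Λ, MeasurableSet U → HallOn W Adj U →
      (∀ γ, MeasurableSet {z | g z = γ}) ∧ ∀ z ∈ U, g z ∈ W ∧ g z • z ∈ U ∧ Adj z (g z • z) ∧
        HallOnOrbit W Adj (U \ {z, g z • z}) z := fun U => by
    by_cases h : MeasurableSet U ∧ HallOn W Adj U
    · obtain ⟨g, hg⟩ := exists_measurable_partner hG hm hdiag hAdj h.1 h.2
      exact ⟨g, fun _ _ => hg⟩
    · exact ⟨fun _ => 1, fun h1 h2 => absurd ⟨h1, h2⟩ h⟩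
  choose G hGs using hstep
  let U : ℕ → Set Z := fun n => n.rec univ fun n V => remaining (A n) V (G V)
  have hUs : ∀ n, U (n + 1) = remaining (A n) (U n) (G (U n)) := fun _ => rfl
  have hinv : ∀ n, MeasurableSet (U n) ∧ HallOn W Adj (U n) ∧ ExpandsOn W Adj n (U n) := by
    intro n
    induction n with
    | zero =>
      refine ⟨.univ, fun F _ => ?_, fun F _ _ _ => ?_⟩
      -- At stage zero the required factor is `1 + 2 ^ 0 = 2`.
      · have := hexp F
        change F.card ≤ (nbhd W Adj univ F).card
        omega
      · have := hexp F
        change (2 ^ 0 + 1) * F.card ≤ 2 ^ 0 * (nbhd W Adj univ F).card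
        omega
    | succ n ih =>
      obtain ⟨h1, h2, h3⟩ := ih
      obtain ⟨h4, h5⟩ := hGs (U n) h1 h2
      exact ⟨measurableSet_remaining hm (hA n) h1 h4,
        hallOn_remaining hG (hAd n) h2 h3 fun z hz =>
          ⟨(h5 z hz.2).1, (h5 z hz.2).2.2.2⟩⟩
  let g : ℕ → Z → Λ := fun n => G (U n)
  have hgm : ∀ n γ, MeasurableSet {z | g n z = γ} := fun n =>
    (hGs (U n) (hinv n).1 (hinv n).2.1).1
  have hgs : ∀ n, ∀ z ∈ U n, g n z ∈ W ∧ g n z • z ∈ U n ∧ Adj z (g n z • z) := fun n z hz =>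
    have h := (hGs (U n) (hinv n).1 (hinv n).2.1).2 z hz
    ⟨h.1, h.2.1, h.2.2.1⟩
  have hanti : Antitone U := antitone_nat_of_succ_le fun n z hz => hz.1
  let R : ℕ → Z → Z → Prop := fun n z w => z ∈ A n ∩ U n ∧ w = g n z • z
  have hR : ∀ n z w, R n z w → Adj z w ∧ (z ∈ U n ∧ z ∉ U (n + 1)) ∧ (w ∈ U n ∧ w ∉ U (n + 1)) := by
    rintro n z _ ⟨hz, rfl⟩
    exact ⟨(hgs n z hz.2).2.2, ⟨hz.2, fun h => (h.2 z hz).1 rfl⟩, (hgs n z hz.2).2.1,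
      fun h => (h.2 z hz).2 rfl⟩
  -- A partner within `A n` would equal the point itself by discreteness, yet the ends of an edge
  -- lie on different sides.
  have hRA : ∀ n z w, R n z w → w ∉ A n := by
    rintro n z w hzw hw
    obtain ⟨hz, rfl⟩ := id hzw
    have : g n z • z = z := hAd n z hz.1 _ (by
      have := Finset.pow_subset_pow_right hG.one_mem (Nat.one_le_two_pow (n := n + 4))
      rw [pow_one] at this
      exact this (hgs n z hz.2).1) hw
    exact hG.side_ne _ _ (hR n _ _ hzw).1 (by rw [this])
  have hRinj : ∀ n z z' w, R n z w → R n z' w → z = z' := by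
    rintro n z z' _ ⟨hz, rfl⟩ ⟨hz', h⟩
    have h' : ((g n z')⁻¹ * g n z) • z = z' := by rw [mul_smul, h, inv_smul_smul]
    refine Eq.trans (hAd n z hz.1 _ ?_ (by rw [h']; exact hz'.1)).symm h'
    have := Finset.pow_subset_pow_right hG.one_mem (m := 2) (n := 2 ^ (n + 4)) (by
      calc 2 = 2 ^ 1 := rfl
        _ ≤ 2 ^ (n + 4) := Nat.pow_le_pow_right (by norm_num) (by omega))
    refine this ?_
    rw [pow_two]
    exact Finset.mul_mem_mul (hG.inv_mem _ (hgs n _ hz'.2).1) (hgs n z hz.2).1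
  let P : Z → Z → Prop := fun z w => ∃ n, R n z w ∨ R n w z
  have hPsymm : ∀ z w, P z w → P w z := fun z w ⟨n, h⟩ => ⟨n, h.symm⟩
  have hPadj : ∀ z w, P z w → Adj z w := by
    rintro z w ⟨n, h | h⟩
    · exact (hR n z w h).1
    · exact hG.symm _ _ (hR n w z h).1
  have hPstage : ∀ n z w, R n z w ∨ R n w z → z ∈ U n ∧ z ∉ U (n + 1) := by
    rintro n z w (h | h)
    · exact (hR n z w h).2.1
    · exact (hR n w z h).2.2
  have hPuniq : ∀ z w w', P z w → P z w' → w = w' := by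
    rintro z w w' ⟨n, h⟩ ⟨m, h'⟩
    have hn := hPstage n z w h
    have hm := hPstage m z w' h'
    obtain rfl : n = m := by
      by_contra hne
      rcases lt_or_gt_of_ne hne with hlt | hlt
      · exact hn.2 (hanti hlt hm.1)
      · exact hm.2 (hanti hlt hn.1)
    rcases h with h | h <;> rcases h' with h' | h'
    · rw [h.2, h'.2]
    · exact absurd h.1.1 (hRA n _ _ h')
    · exact absurd h'.1.1 (hRA n _ _ h)
    · exact hRinj n _ _ _ h h'
  have hPtot : ∀ z, ∃ w, P z w := by
    intro z
    -- A point of `A n` that survives to stage `n` is removed there, and the sets `A n` cover.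
    have hex : ∃ n, z ∉ U n := by
      obtain ⟨n, hn⟩ := hAc z
      refine ⟨n + 1, fun h => ?_⟩
      exact (h.2 z ⟨hn, h.1⟩).1 rfl
    have h0 : Nat.find hex ≠ 0 := fun h0 => by
      have := Nat.find_spec hex
      rw [h0] at this
      exact this (mem_univ z)
    obtain ⟨m, hm⟩ := Nat.exists_eq_add_one_of_ne_zero h0
    have h1 : z ∉ U (m + 1) := hm ▸ Nat.find_spec hex
    have h2 : z ∈ U m := by
      by_contra h
      have := Nat.find_min' hex h
      omega
    rw [hUs] at h1
    simp only [remaining, mem_ofPred_eq, not_and, not_forall] at h1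
    obtain ⟨z', hz', h3⟩ := h1 h2
    by_cases hzz : z = z'
    · subst hzz
      exact ⟨_, m, Or.inl ⟨hz', rfl⟩⟩
    · have h4 : z = g m z' • z' := by
        by_contra h4
        exact h3 hzz h4
      exact ⟨z', m, Or.inr ⟨hz', h4⟩⟩
  obtain ⟨h, hhm, hh⟩ := exists_measurable_choice (fun γ : Λ => {z | P z (γ • z)}) fun γ => by
    have hQ : ∀ n (κ : Λ), MeasurableSet {z | R n z (κ • z)} := fun n κ =>
      ((hA n).inter (hinv n).1).inter (measurableSet_smul_eq_choice hm hdiag (hgm n) κ)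
    have : {z | P z (γ • z)} = ⋃ n, ({z | R n z (γ • z)} ∪
        (fun z => γ • z) ⁻¹' {z | R n z (γ⁻¹ • z)}) := by
      ext z
      simp [P]
    rw [this]
    exact .iUnion fun n => (hQ n γ).union (hm γ (hQ n γ⁻¹))
  have hh' : ∀ z, P z (h z • z) := fun z => by
    refine hh z ?_
    obtain ⟨w, hw⟩ := hPtot z
    obtain ⟨γ, -, rfl⟩ := hG.exists_mem _ _ (hPadj z w hw)
    exact ⟨γ, hw⟩
  exact ⟨h, hhm, fun z => ⟨hPadj _ _ (hh' z),
    hPuniq _ _ _ (hh' (h z • z)) (hPsymm _ _ (hh' z))⟩⟩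

end MeasurableMatching

end Matching

/-! ### The demand graph and its two-to-one map -/

section TwoToOneMaps

open Set Function Pointwise

/-- Two groups act on a product coordinatewise. -/
@[reducible] def prodMulAction (G H X Y : Type*) [Group G] [Group H] [MulAction G X]
    [MulAction H Y] : MulAction (G × H) (X × Y) where
  smul g z := (g.1 • z.1, g.2 • z.2)
  one_smul z := Prod.ext (one_smul G z.1) (one_smul H z.2)
  mul_smul g h z := Prod.ext (mul_smul g.1 h.1 z.1) (mul_smul g.2 h.2 z.2)

/-- The graph that joins each point, in the copy of index zero, to both copies of the points that
it can be moved to by `S`. -/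
def demandAdj {Γ X : Type*} [Group Γ] [MulAction Γ X] (S : Finset Γ) (z w : X × Fin 3) : Prop :=
  (z.2 = 0 ↔ w.2 ≠ 0) ∧ ∃ s ∈ S, w.1 = s • z.1

section TwoToOne

open scoped Classical

variable {Γ X : Type*} [Group Γ] [MulAction Γ X] {S : Finset Γ}

attribute [local instance] prodMulAction

/-- The factor `Equiv.Perm (Fin 3)` lets group elements change the copy: an edge is a move by `s`
together with a swap of indices. -/
theorem isLocalGraph_demandAdj (h1 : 1 ∈ S) (hinv : ∀ s ∈ S, s⁻¹ ∈ S) :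
    IsLocalGraph (S ×ˢ (Finset.univ : Finset (Equiv.Perm (Fin 3)))) (demandAdj (X := X) S)
      (fun z => decide (z.2 = 0)) where
  one_mem := by simp [h1]
  inv_mem γ hγ := by
    simp only [Finset.mem_product, Finset.mem_univ, and_true] at hγ ⊢
    exact hinv _ hγ
  symm z w := by
    rintro ⟨h, s, hs, hw⟩
    refine ⟨?_, s⁻¹, hinv s hs, by rw [hw, inv_smul_smul]⟩
    tauto
  exists_mem z w := by
    rintro ⟨h, s, hs, hw⟩
    exact ⟨(s, Equiv.swap z.2 w.2), by simpa using hs,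
      Prod.ext hw (Equiv.swap_apply_left _ _).symm⟩
  side_ne z w := by
    rintro ⟨h, -⟩ h'
    have h'' : z.2 = 0 ↔ w.2 = 0 := by simpa using h'
    tauto

/-- The worst case lies in copies 1 and 2: projecting to `X` may halve the set and its neighbours
occupy one copy only, so the factor four becomes two. -/
theorem two_mul_card_le_card_nbhd (h1 : 1 ∈ S) (hinv : ∀ s ∈ S, s⁻¹ ∈ S)
    (hexp : ∀ F : Finset X, 4 * F.card ≤ (S • F).card) (F : Finset (X × Fin 3)) :
    2 * F.card ≤ (nbhd (S ×ˢ (Finset.univ : Finset (Equiv.Perm (Fin 3)))) (demandAdj S)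
      univ F).card := by
  have hG := isLocalGraph_demandAdj (X := X) h1 hinv
  set F₀ := F.filter (·.2 = 0)
  set F₁ := F.filter (¬ ·.2 = 0)
  set P₀ := F₀.image Prod.fst
  set P₁ := F₁.image Prod.fst
  have hcard : F₀.card + F₁.card = F.card := Finset.card_filter_add_card_filter_not _
  have hP₀ : F₀.card ≤ P₀.card := by
    refine (Finset.card_image_of_injOn fun z hz w hw h => ?_).ge
    exact Prod.ext h ((Finset.mem_filter.1 hz).2.trans (Finset.mem_filter.1 hw).2.symm)
  have hP₁ : F₁.card ≤ P₁.card * 2 := by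
    have : F₁ ⊆ P₁ ×ˢ ({1, 2} : Finset (Fin 3)) := fun z hz => by
      refine Finset.mem_product.2 ⟨Finset.mem_image_of_mem _ hz, ?_⟩
      have := (Finset.mem_filter.1 hz).2
      revert this
      generalize z.2 = i
      revert i
      decide
    simpa using Finset.card_le_card this
  have hd : Disjoint ((S • P₀) ×ˢ ({1, 2} : Finset (Fin 3))) ((S • P₁) ×ˢ ({0} : Finset (Fin 3))) :=
    Finset.disjoint_product.2 (Or.inr (by decide))
  have hsub : ((S • P₀) ×ˢ ({1, 2} : Finset (Fin 3))) ∪ ((S • P₁) ×ˢ ({0} : Finset (Fin 3))) ⊆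
      nbhd (S ×ˢ (Finset.univ : Finset (Equiv.Perm (Fin 3)))) (demandAdj S) univ F := by
    rintro ⟨y, j⟩ hy
    refine (mem_nbhd hG).2 ⟨mem_univ _, ?_⟩
    rcases Finset.mem_union.1 hy with hy | hy <;>
    · obtain ⟨hy1, hy2⟩ := Finset.mem_product.1 hy
      obtain ⟨s, hs, x, hx, rfl⟩ := Finset.mem_smul.1 hy1
      obtain ⟨z, hz, rfl⟩ := Finset.mem_image.1 hx
      obtain ⟨hzF, hz0⟩ := Finset.mem_filter.1 hz
      refine ⟨z, hzF, ?_, s, hs, rfl⟩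
      simp only [Finset.mem_insert, Finset.mem_singleton] at hy2
      simp only [hz0, true_iff, false_iff, not_not, ne_eq]
      clear hy hy1
      revert hy2
      generalize j = i
      revert i
      decide
  have := Finset.card_le_card hsub
  rw [Finset.card_union_of_disjoint hd, Finset.card_product, Finset.card_product] at this
  have e2 : ({1, 2} : Finset (Fin 3)).card = 2 := by decide
  have e1 : ({0} : Finset (Fin 3)).card = 1 := by decide
  rw [e1, e2] at this
  have h0 := hexp P₀
  have h1 := hexp P₁
  omega

theorem map_mem_pow {Λ : Type*} [Group Λ] (f : Λ →* Γ) {W : Finset Λ} (hW : ∀ γ ∈ W, f γ ∈ S)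
    {k : ℕ} {γ : Λ} (h : γ ∈ W ^ k) : f γ ∈ S ^ k := by
  induction k generalizing γ with
  | zero =>
    simp only [pow_zero, Finset.mem_one] at h ⊢
    rw [h, map_one]
  | succ k ih =>
    rw [pow_succ] at h ⊢
    obtain ⟨a, ha, b, hb, rfl⟩ := Finset.mem_mul.1 h
    rw [map_mul]
    exact Finset.mul_mem_mul (ih ha) (hW b hb)

variable [MeasurableSpace X] [Countable Γ]

/-- An expanding action with discrete measurable covers admits a measurable two-to-one map. -/
theorem exists_twoToOne (hm : ∀ γ : Γ, Measurable fun x : X => γ • x)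
    (hdiag : ∀ γ : Γ, MeasurableSet {x : X | γ • x = x}) (h1 : 1 ∈ S) (hinv : ∀ s ∈ S, s⁻¹ ∈ S)
    (hexp : ∀ F : Finset X, 4 * F.card ≤ (S • F).card) (A : ℕ → Set X)
    (hA : ∀ n, MeasurableSet (A n))
    (hAd : ∀ n, ∀ x ∈ A n, ∀ γ ∈ S ^ (2 ^ (3 * n + 6)), γ • x ∈ A n → γ • x = x)
    (hAc : ∀ x, ∃ n, x ∈ A n) :
    ∃ e : X ≃ᵐ X × Bool, FinitelyMoves Γ (parent e) := by
  have hG := isLocalGraph_demandAdj (X := X) h1 hinv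
  have hm' : ∀ γ : Γ × Equiv.Perm (Fin 3), Measurable fun z : X × Fin 3 => γ • z := fun γ =>
    ((hm γ.1).comp measurable_fst).prodMk ((measurable_of_finite γ.2).comp measurable_snd)
  have hdiag' : ∀ γ : Γ × Equiv.Perm (Fin 3), MeasurableSet {z : X × Fin 3 | γ • z = z} := by
    intro γ
    have : {z : X × Fin 3 | γ • z = z} =
        Prod.fst ⁻¹' {x | γ.1 • x = x} ∩ Prod.snd ⁻¹' {i | γ.2 i = i} := by
      ext z; exact Prod.ext_iff
    rw [this]
    exact (measurable_fst (hdiag γ.1)).inter (measurable_snd (Set.toFinite _).measurableSet)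
  have hAdj : ∀ γ : Γ × Equiv.Perm (Fin 3),
      MeasurableSet {z : X × Fin 3 | demandAdj S z (γ • z)} := by
    intro γ
    have : {z : X × Fin 3 | demandAdj S z (γ • z)} =
        Prod.snd ⁻¹' {i | i = 0 ↔ γ.2 i ≠ 0} ∩
          ⋃ s ∈ S, Prod.fst ⁻¹' {x : X | γ.1 • x = s • x} := by
      ext z
      simp only [mem_inter_iff, mem_iUnion, exists_prop]
      rfl
    rw [this]
    exact (measurable_snd (Set.toFinite _).measurableSet).inter
      (Finset.measurableSet_biUnion _ fun s _ =>
        measurable_fst (measurableSet_smul_eq_smul hm hdiag _ _))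
  -- The copies are treated in turn, three stages for each `A n`. Stage `n` needs exponent `2 ^ (n +
  -- 4)`, and `n + 4 ≤ 3 * (n / 3) + 6`.
  let A' : ℕ → Set (X × Fin 3) := fun n => {z | z.1 ∈ A (n / 3) ∧ z.2.1 = n % 3}
  obtain ⟨h, hh, hM⟩ := exists_measurable_matching hG hm' hdiag' hAdj A'
    (fun n => (measurable_fst (hA _)).inter
      (measurable_snd (Set.toFinite {i : Fin 3 | i.1 = n % 3}).measurableSet))
    (by
      rintro n z ⟨hz1, hz2⟩ γ hγ ⟨hγz1, hγz2⟩
      have hpow : 2 ^ (n + 4) ≤ 2 ^ (3 * (n / 3) + 6) :=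
        Nat.pow_le_pow_right (by norm_num) (by omega)
      have hγ' : γ.1 ∈ S ^ 2 ^ (n + 4) := map_mem_pow (MonoidHom.fst _ _)
        (fun γ hγ => (Finset.mem_product.1 hγ).1) hγ
      exact Prod.ext (hAd (n / 3) z.1 hz1 γ.1
        (Finset.pow_subset_pow_right h1 hpow hγ') hγz1)
        (Fin.ext (hγz2.trans hz2.symm)))
    (by
      rintro ⟨x, i⟩
      obtain ⟨n, hn⟩ := hAc x
      refine ⟨3 * n + i.1, ?_, ?_⟩
      · rw [show (3 * n + i.1) / 3 = n by omega]; exact hn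
      · simp only; omega)
    (two_mul_card_le_card_nbhd h1 hinv hexp)
  set M : X × Fin 3 → X × Fin 3 := fun z => h z • z with hMdef
  have hMm : Measurable M := measurable_of_measurable_pieces h hh (fun γ z => γ • z) hm'
  have hMadj : ∀ z, demandAdj S z (M z) := fun z => (hM z).1
  have hMM : ∀ z, M (M z) = z := fun z => (hM z).2
  let ix : Bool → Fin 3 := fun b => cond b 2 1
  have hix : ∀ i : Fin 3, i ≠ 0 → ix (decide (i = 2)) = i := by decide
  have hix' : ∀ b, decide (ix b = 2) = b := by decide
  have hix0 : ∀ b, ix b ≠ 0 := by decide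
  have hM0 : ∀ x, (M (x, 0)).2 ≠ 0 := fun x => (hMadj (x, 0)).1.1 rfl
  have hM1 : ∀ y b, (M (y, ix b)).2 = 0 := fun y b => by
    by_contra h
    exact hix0 b ((hMadj (y, ix b)).1.2 h)
  refine ⟨⟨⟨fun x => ((M (x, 0)).1, decide ((M (x, 0)).2 = 2)), fun q => (M (q.1, ix q.2)).1,
    fun x => ?_, fun q => ?_⟩, ?_, ?_⟩, S, fun x => ?_⟩
  · simp only [hix _ (hM0 x), Prod.mk.eta, hMM]
  · have : ((M (q.1, ix q.2)).1, (0 : Fin 3)) = M (q.1, ix q.2) := Prod.ext rfl (hM1 _ _).symm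
    simp only [this, hMM, hix', Prod.mk.eta]
  · have h0 : Measurable fun x : X => M (x, 0) := hMm.comp measurable_prodMk_right
    exact (measurable_fst.comp h0).prodMk
      ((measurable_of_finite fun i : Fin 3 => decide (i = 2)).comp (measurable_snd.comp h0))
  · exact measurable_fst.comp (hMm.comp
      (measurable_fst.prodMk ((measurable_of_finite ix).comp measurable_snd)))
  · obtain ⟨-, s, hs, hx⟩ := hMadj (x, 0)
    exact ⟨s, hs, hx⟩

/-- An expanding action with discrete measurable covers admits a measurable free action of the
free group by finitely many moves. -/
theorem exists_measurable_freeAction (hm : ∀ γ : Γ, Measurable fun x : X => γ • x)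
    {ρ : X → ℝ} (hρ : Measurable ρ) (hρi : Injective ρ) (h1 : 1 ∈ S) (hinv : ∀ s ∈ S, s⁻¹ ∈ S)
    (hexp : ∀ F : Finset X, 4 * F.card ≤ (S • F).card) (A : ℕ → Set X)
    (hA : ∀ n, MeasurableSet (A n))
    (hAd : ∀ n, ∀ x ∈ A n, ∀ γ ∈ S ^ (2 ^ (3 * n + 6)), γ • x ∈ A n → γ • x = x)
    (hAc : ∀ x, ∃ n, x ∈ A n) :
    ∃ b : MulAction (FreeGroup (Fin 2)) X,
      FreeAction (FreeGroup (Fin 2)) X ∧ LipschitzAction Γ (FreeGroup (Fin 2)) X ∧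
      ∀ δ : FreeGroup (Fin 2), Measurable fun x : X => δ • x := by
  have hdiag : ∀ γ : Γ, MeasurableSet {x : X | γ • x = x} := fun γ => by
    have : {x : X | γ • x = x} = {x | ρ (γ • x) = ρ x} := by ext x; simp [hρi.eq_iff]
    rw [this]
    exact measurableSet_eq_fun (hρ.comp (hm γ)) hρ
  obtain ⟨e, he⟩ := exists_twoToOne hm hdiag h1 hinv hexp A hA hAd hAc
  obtain ⟨e', hper, he'⟩ := exists_acyclic e hρ hρi he
  exact exists_freeAction_of_acyclic e' hper he'

end TwoToOne

theorem countable_closure_finset {Γ : Type*} [Group Γ] (S : Finset Γ) :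
    Countable (Subgroup.closure (S : Set Γ)) := by
  have h : (FreeGroup.lift ((↑) : S → Γ)).range = Subgroup.closure (S : Set Γ) := by
    rw [FreeGroup.range_lift_eq_closure]
    simp
  rw [← h]
  have : Countable (FreeGroup S) := Quotient.countable
  exact (MonoidHom.rangeRestrict_surjective (FreeGroup.lift ((↑) : S → Γ))).countable

end TwoToOneMaps

/-! ### The theorem -/

open Pointwise

theorem theorem1p2 {Γ X : Type*} [Group Γ] [TopologicalSpace X] [PolishSpace X]
    [MeasurableSpace X] [BorelSpace X] [MulAction Γ X]
    (hBorel : ∀ γ : Γ, Measurable (fun x : X => γ • x))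
    (hna : ¬ AmenableAction Γ X) :
    ∃ b : MulAction (FreeGroup (Fin 2)) X,
      FreeAction (FreeGroup (Fin 2)) X ∧
      LipschitzAction Γ (FreeGroup (Fin 2)) X ∧
      (∀ δ : FreeGroup (Fin 2), BaireMeasurableMap (fun x : X => δ • x)) ∧
      ∃ B : Set X, MeasurableSet B ∧ B ∈ residual X ∧
        (∀ (δ : FreeGroup (Fin 2)), ∀ x ∈ B, δ • x ∈ B) ∧
        (∀ δ : FreeGroup (Fin 2), Measurable (fun x : B => δ • (x : X))) := by
  classical
  obtain ⟨S, hS⟩ := exists_expanding_of_not_amenableAction hna 4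
  -- `Γ` may be uncountable, but the finite `S` that witnesses expansion generates a countable
  -- group.
  let H := Subgroup.closure (S : Set Γ)
  have hH : Countable H := countable_closure_finset S
  let S₀ : Finset H := S.attach.image fun s => ⟨s.1, Subgroup.subset_closure s.2⟩
  let S₁ : Finset H := insert 1 (S₀ ∪ S₀⁻¹)
  have h1 : 1 ∈ S₁ := Finset.mem_insert_self _ _
  have hinv : ∀ s ∈ S₁, s⁻¹ ∈ S₁ := by
    intro s hs
    simp only [S₁, Finset.mem_insert, Finset.mem_union, Finset.mem_inv', inv_inv, inv_eq_one]
      at hs ⊢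
    tauto
  have hexp : ∀ F : Finset X, 4 * F.card ≤ (S₁ • F).card := fun F => by
    refine (hS F).trans (Finset.card_le_card fun y hy => ?_)
    obtain ⟨s, hs, x, hx, rfl⟩ := Finset.mem_smul.1 hy
    refine Finset.mem_smul.2 ⟨⟨s, Subgroup.subset_closure hs⟩, ?_, x, hx, rfl⟩
    exact Finset.mem_insert_of_mem (Finset.mem_union_left _
      (Finset.mem_image.2 ⟨⟨s, hs⟩, Finset.mem_attach _ _, rfl⟩))
  have hBorelH : ∀ γ : H, Measurable fun x : X => γ • x := fun γ => hBorel γ.1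
  obtain ⟨B, A, hBm, hBr, hBi, hAm, hAd, hAc⟩ := exists_discrete_seq_cover hBorelH
    fun n => S₁ ^ (2 ^ (3 * n + 6))
  obtain ⟨ρ, hρ⟩ := MeasureTheory.exists_measurableEmbedding_real X
  -- From here `X` carries the σ-algebra of sets with measurable trace on `B`. Invariance of `B`
  -- keeps the action measurable, and the sets `A n` become measurable although they are arbitrary
  -- off `B`.
  have hsmul : ∀ (γ : H) (s : Set X), MeasurableSet (((↑) : B → X) ⁻¹' s) →
      MeasurableSet (((↑) : B → X) ⁻¹' ((fun x => γ • x) ⁻¹' s)) := fun γ s hs => by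
    have : Measurable fun x : B => (⟨γ • x.1, (hBi γ x.1).2 x.2⟩ : B) :=
      ((hBorelH γ).comp measurable_subtype_coe).subtype_mk
    exact this hs
  have hA : ∀ n, MeasurableSet (((↑) : B → X) ⁻¹' A n) := fun n => by
    have := measurable_subtype_coe (p := (· ∈ B)) (hAm n)
    have hset : ((↑) : B → X) ⁻¹' (A n ∩ B) = (↑) ⁻¹' A n := by ext x; simp
    rwa [hset] at this
  have hρB : ∀ s : Set ℝ, MeasurableSet s → MeasurableSet (((↑) : B → X) ⁻¹' (ρ ⁻¹' s)) :=
    fun s hs => measurable_subtype_coe (hρ.measurable hs)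
  obtain ⟨b, hbf, hbl, hbm⟩ := @exists_measurable_freeAction H X _ _ S₁
    (MeasurableSpace.map ((↑) : B → X) inferInstance) _ hsmul ρ hρB hρ.injective h1 hinv hexp A hA
    (by convert hAd) hAc
  have hpre : ∀ (δ : FreeGroup (Fin 2)) (C : Set X), MeasurableSet C →
      MeasurableSet (((↑) : B → X) ⁻¹' ((fun x => δ • x) ⁻¹' C)) := fun δ C hC =>
    hbm δ (measurable_subtype_coe (p := (· ∈ B)) hC)
  refine ⟨b, hbf, fun δ => ?_, fun δ C hC => ?_, B, hBm, hBr, fun δ x hx => ?_, fun δ C hC => ?_⟩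
  · obtain ⟨T, hT⟩ := hbl δ
    refine ⟨T.image Subtype.val, fun x => ?_⟩
    obtain ⟨γ, hγ, h⟩ := hT x
    exact ⟨γ.1, Finset.mem_image_of_mem _ hγ, h⟩
  -- The preimage of `C` agrees on the comeager set `B` with a Borel set.
  · have h' := (hBm.subtype_image (hpre δ C hC)).baireMeasurableSet
    rw [Subtype.image_preimage_coe] at h'
    refine h'.congr (Filter.eventuallyEq_set.2 ?_)
    filter_upwards [hBr] with x hx
    simp [hx]
  · obtain ⟨T, hT⟩ := hbl δ
    obtain ⟨γ, -, h⟩ := hT x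
    rw [h]
    exact (hBi γ x).2 hx
  · exact hpre δ C hC
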